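/- **Theorem (classification of irreducible modules).** Let $\mathcal C$ be one of the following five categories. The objects are $[n]=\{1,\dots,n\}$, $n\ge 1$, and the morphisms $[m]\to[n]$ are: all maps (FA); weakly increasing maps (OA); maps that become weakly increasing after precomposition with a rotation $i\mapsto i+r \pmod m$ of $[m]$, i.e. maps preserving the cyclic order (CA); maps that are weakly increasing or weakly decreasing, i.e. maps preserving betweenness (BA); maps that become weakly increasing or weakly decreasing after precomposition with a rotation of $[m]$, i.e. maps preserving the separation relation (SA). Let $k$ be a field of characteristic $0$. A $\mathcal C$-module is a covariant functor $\mathcal C\to k\text{-Mod}$. Let $G_n=\mathrm{Aut}_{\mathcal C}([n])$, let $\mathrm{Irr}(G_n)$ be the set of isomorphism classes of irreducible $kG_n$-modules, let $\Delta_n$ be the quotient of $k\mathcal C([n],-)$ by the submodule spanned by the non-injective morphisms, and let $\Delta_{n,\lambda}=\Delta_n\otimes_{kG_n}\lambda$ for $\lambda\in\mathrm{Irr}(G_n)$. Call $\lambda\in \mathrm{Irr}(G_n)$ *singular* if there is a nonzero homomorphism $\Delta_{n+1}\to\Delta_{n,\lambda}$, and *regular* otherwise. Call $(\lambda,\mu)$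 with $\lambda\in\mathrm{Irr}(G_{n+1})$, $\mu\in\mathrm{Irr}(G_n)$ a *singular pair* if there is a nonzero homomorphism $\Delta_{n+1,\lambda}\to\Delta_{n,\mu}$. The *top* of a module is its quotient by the intersection of its maximal submodules, and its *socle* is the sum of its simple submodules. (a) For each $n\ge1$, the singular pairs $(\lambda,\mu)\in\mathrm{Irr}(G_{n+1})\times\mathrm{Irr}(G_n)$ are exactly the following, where $\sigma$ denotes the rotation $i\mapsto i+1$ and $\tau$ the reversal $i\mapsto N+1-i$ of $[N]$: - FA: $(\mathrm{sgn}_{n+1},\mathrm{sgn}_n)$; - OA: $(\mathrm{triv},\mathrm{triv})$; - CA: $\sigma$ acts on $\lambda$ as $(-1)^n$ and on $\mu$ as $(-1)^{n-1}$; - BA: for some $\varepsilon\in\{1,-1\}$, $\tau$ acts on $\lambda$ as $\varepsilon$ and on $\mu$ as $(-1)^n\varepsilon$; - SA: $\sigma$ acts on $\lambda$ as $(-1)^n$ and on $\mu$ as $(-1)^{n-1}$, and for some $\varepsilon\in\{1,-1\}$, $\tau$ acts on $\lambda$ as $\varepsilon$ and on $\mu$ as $(-1)^n\varepsilon$. Moreover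 $\mu\in\mathrm{Irr}(G_n)$ is singular if and only if there is a $\lambda\in\mathrm{Irr}(G_{n+1})$ such that $(\lambda,\mu)$ is in this list. (b) There is a bijection from the set of pairs $(n,\lambda)$ with $n\ge1$ and $\lambda\in\mathrm{Irr}(G_n)$ to the set of isomorphism classes of irreducible $\mathcal C$-modules such that: 1. if $\lambda$ is regular, the irreducible module corresponding to $(n,\lambda)$ is $\Delta_{n,\lambda}$; 2. if $\lambda$ is singular, the irreducible module corresponding to $(n,\lambda)$ is the top of $\Delta_{n,\lambda}$; 3. if $n\ge2$ and $(\lambda,\mu)$ is a singular pair with $\lambda\in\mathrm{Irr}(G_n)$ and $\mu\in\mathrm{Irr}(G_{n-1})$, the irreducible module corresponding to $(n,\lambda)$ is also the socle of $\Delta_{n-1,\mu}$. -/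

import Mathlib

open CategoryTheory TensorProduct

universe u

noncomputable section

/-! ### The five categories of finite substructures

The object `[n]` (`n ≥ 1`) is modelled on `Fin n = {0, …, n-1}`, i.e. all indices are shifted
down by one. -/

/-- The five types of highly homogeneous structure: pure set, linear order, cyclic order,
linear betweenness relation, separation relation. -/
inductive CameronType
  | FA
  | OA
  | CA
  | BA
  | SA

/-- The rotation `i ↦ i + r (mod n)` of `[n]`. -/
def rot (n r : ℕ) (i : Fin n) : Fin n :=
  ⟨(i + r) % n, Nat.mod_lt _ (Nat.zero_lt_of_lt i.isLt)⟩

/-- `f` preserves the (weak) cyclic order: up to a rotation of the source, it is weakly increasing.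
Equivalently, `f` sends weakly cyclically ordered 4-tuples to weakly cyclically ordered 4-tuples. -/
def IsCyclicMono {m n : ℕ} (f : Fin m → Fin n) : Prop :=
  ∃ r : ℕ, Monotone (f ∘ rot m r)

/-- `f` reverses the (weak) cyclic order: up to a rotation of the source, it is weakly decreasing. -/
def IsCyclicAnti {m n : ℕ} (f : Fin m → Fin n) : Prop :=
  ∃ r : ℕ, Antitone (f ∘ rot m r)

/-- The relation-preserving maps `[m] → [n]` for each of the five structures. -/
def IsMor (t : CameronType) {m n : ℕ} (f : Fin m → Fin n) : Prop :=
  match t with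
  | .FA => True
  | .OA => Monotone f
  | .CA => IsCyclicMono f
  | .BA => Monotone f ∨ Antitone f
  | .SA => IsCyclicMono f ∨ IsCyclicAnti f

theorem rot_zero (n : ℕ) : rot n 0 = id := by
  funext i; apply Fin.ext; simp [rot, Nat.mod_eq_of_lt i.isLt]

theorem rot_comp (n a b : ℕ) : rot n a ∘ rot n b = rot n (b + a) := by
  funext i; apply Fin.ext; simp [rot, Nat.add_assoc]

theorem exists_rot_shift {m n : ℕ} (F : Fin m → Fin n) (hF : Monotone F) (s : ℕ) (hs : s ≤ n) :
    ∃ c : ℕ, Monotone (rot n s ∘ F ∘ rot m c) := by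
  classical
  -- `c` counts the points that do not wrap around
  let c : ℕ := (Finset.univ.filter fun i : Fin m => (F i : ℕ) + s < n).card
  have hc : ∀ i : Fin m, (F i : ℕ) + s < n ↔ (i : ℕ) < c := by
    intro i
    constructor
    · intro h
      have hsub : Finset.Iic i ⊆ Finset.univ.filter fun j : Fin m => (F j : ℕ) + s < n := by
        intro j hj
        have h1 : F j ≤ F i := hF (Finset.mem_Iic.1 hj)
        have h2 : (F j : ℕ) ≤ F i := h1
        simp only [Finset.mem_filter, Finset.mem_univ, true_and]
        omega
      have := Finset.card_le_card hsub
      rw [Fin.card_Iic] at this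
      exact this
    · intro h
      by_contra hn
      have hsub : (Finset.univ.filter fun j : Fin m => (F j : ℕ) + s < n) ⊆ Finset.Iio i := by
        intro j hj
        simp only [Finset.mem_filter, Finset.mem_univ, true_and] at hj
        rw [Finset.mem_Iio]
        by_contra hij
        have h1 : F i ≤ F j := hF (not_lt.1 hij)
        have h2 : (F i : ℕ) ≤ F j := h1
        omega
      have := Finset.card_le_card hsub
      rw [Fin.card_Iio] at this
      exact absurd h (not_lt.2 this)
  have hcm : c ≤ m := by
    have := Finset.card_le_univ (Finset.univ.filter fun i : Fin m => (F i : ℕ) + s < n)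
    simpa using this
  refine ⟨c, fun i j hij => ?_⟩
  have hval : ∀ i : Fin m, ((rot m c i : Fin m) : ℕ) = if (i : ℕ) + c < m then i + c else i + c - m := by
    intro i
    have := i.isLt
    split_ifs with h
    · exact Nat.mod_eq_of_lt h
    · change (i + c) % m = _
      rw [Nat.mod_eq_sub_mod (by omega), Nat.mod_eq_of_lt (by omega)]
  have hval' : ∀ x : Fin n, ((rot n s x : Fin n) : ℕ) = if (x : ℕ) + s < n then x + s else x + s - n := by
    intro i
    have := i.isLt
    split_ifs with h
    · exact Nat.mod_eq_of_lt h
    · change (i + s) % n = _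
      rw [Nat.mod_eq_sub_mod (by omega), Nat.mod_eq_of_lt (by omega)]
  have hij' : (i : ℕ) ≤ j := hij
  have hi := hval i
  have hj := hval j
  have hil := i.isLt
  have hjl := j.isLt
  change ((rot n s (F (rot m c i)) : Fin n) : ℕ) ≤ (rot n s (F (rot m c j)) : Fin n)
  rw [hval', hval']
  have ci := hc (rot m c i)
  have cj := hc (rot m c j)
  have li := (F (rot m c i)).isLt
  have lj := (F (rot m c j)).isLt
  have hmono : ((rot m c i : Fin m) : ℕ) ≤ (rot m c j : Fin m) →
      (F (rot m c i) : ℕ) ≤ F (rot m c j) := fun h => hF h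
  split_ifs at hi hj ⊢ <;> omega

theorem IsCyclicMono.comp {l m n : ℕ} {g : Fin m → Fin n} {f : Fin l → Fin m}
    (hg : IsCyclicMono g) (hf : IsCyclicMono f) : IsCyclicMono (g ∘ f) := by
  obtain ⟨b, hb⟩ := hg
  obtain ⟨a, ha⟩ := hf
  obtain ⟨c, hc⟩ := exists_rot_shift _ ha (m - b % m) (Nat.sub_le _ _)
  refine ⟨c + a, ?_⟩
  have key : rot m b ∘ rot m (m - b % m) = id := by
    rw [rot_comp]
    funext i
    have hm : 0 < m := Nat.zero_lt_of_lt i.isLt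
    apply Fin.ext
    have h1 : b % m < m := Nat.mod_lt _ hm
    have h2 : (m - b % m + b) = m * (1 + b / m) := by
      have := Nat.mod_add_div b m
      rw [Nat.mul_add, Nat.mul_one]
      omega
    change ((i : ℕ) + (m - b % m + b)) % m = i
    rw [h2, Nat.add_mul_mod_self_left, Nat.mod_eq_of_lt i.isLt]
  have : (g ∘ f) ∘ rot l (c + a) = (g ∘ rot m b) ∘ (rot m (m - b % m) ∘ (f ∘ rot l a) ∘ rot l c) := by
    calc (g ∘ f) ∘ rot l (c + a) = g ∘ id ∘ f ∘ rot l (c + a) := rfl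
      _ = g ∘ (rot m b ∘ rot m (m - b % m)) ∘ f ∘ (rot l a ∘ rot l c) := by rw [key, rot_comp]
      _ = _ := rfl
  rw [this]
  exact hb.comp hc

theorem isCyclicAnti_iff {m n : ℕ} {f : Fin m → Fin n} :
    IsCyclicAnti f ↔ IsCyclicMono (Fin.rev ∘ f) := by
  refine exists_congr fun r => ⟨fun h i j hij => Fin.rev_le_rev.2 (h hij), fun h i j hij => ?_⟩
  exact Fin.rev_le_rev.1 (h hij)

theorem rev_comp_rev (n : ℕ) : (Fin.rev : Fin n → Fin n) ∘ Fin.rev = id := by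
  funext i; simp

theorem IsCyclicMono.conj_rev {m n : ℕ} {g : Fin m → Fin n} (hg : IsCyclicMono g) :
    IsCyclicMono (Fin.rev ∘ g ∘ Fin.rev) := by
  obtain ⟨r, hr⟩ := hg
  refine ⟨m - r % m, ?_⟩
  have key : (Fin.rev : Fin m → Fin m) ∘ rot m (m - r % m) = rot m r ∘ Fin.rev := by
    funext i
    have hm : 0 < m := Nat.zero_lt_of_lt i.isLt
    have hi := i.isLt
    have h1 : r % m < m := Nat.mod_lt _ hm
    apply Fin.ext
    simp only [Function.comp_apply, Fin.val_rev, rot]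
    rw [← Nat.add_mod_mod (m - (i + 1)) r m]
    generalize r % m = q at *
    rcases Nat.lt_or_ge (i + (m - q)) m with h | h
    · rw [Nat.mod_eq_of_lt h, Nat.mod_eq_sub_mod (by omega), Nat.mod_eq_of_lt (by omega)]; omega
    · rw [Nat.mod_eq_sub_mod h, Nat.mod_eq_of_lt (by omega), Nat.mod_eq_of_lt (by omega)]; omega
  have : (Fin.rev ∘ g ∘ Fin.rev) ∘ rot m (m - r % m) = Fin.rev ∘ (g ∘ rot m r) ∘ Fin.rev := by
    calc (Fin.rev ∘ g ∘ Fin.rev) ∘ rot m (m - r % m)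
        = Fin.rev ∘ g ∘ (Fin.rev ∘ rot m (m - r % m)) := rfl
      _ = _ := by rw [key]; rfl
  rw [this]
  intro i j hij
  exact Fin.rev_le_rev.2 (hr (Fin.rev_le_rev.2 hij))

theorem isMor_id (t : CameronType) (n : ℕ) : IsMor t (id : Fin n → Fin n) := by
  have h : IsCyclicMono (id : Fin n → Fin n) := ⟨0, by rw [rot_zero]; exact monotone_id⟩
  cases t
  · trivial
  · exact monotone_id
  · exact h
  · exact Or.inl monotone_id
  · exact Or.inl h

theorem IsMor.comp {t : CameronType} {l m n : ℕ} {g : Fin m → Fin n} {f : Fin l → Fin m}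
    (hg : IsMor t g) (hf : IsMor t f) : IsMor t (g ∘ f) := by
  cases t
  · trivial
  · exact Monotone.comp hg hf
  · exact IsCyclicMono.comp hg hf
  · rcases hg with hg | hg <;> rcases hf with hf | hf
    · exact Or.inl (hg.comp hf)
    · exact Or.inr (hg.comp_antitone hf)
    · exact Or.inr (hg.comp_monotone hf)
    · exact Or.inl (hg.comp hf)
  · simp only [IsMor, isCyclicAnti_iff] at hg hf ⊢
    have flip : ∀ h : Fin m → Fin n, h ∘ f = (h ∘ Fin.rev) ∘ (Fin.rev ∘ f) := fun h => by
      calc h ∘ f = h ∘ id ∘ f := rfl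
        _ = _ := by rw [← rev_comp_rev]; rfl
    rcases hg with hg | hg <;> rcases hf with hf | hf
    · exact Or.inl (hg.comp hf)
    · refine Or.inr ?_
      have : Fin.rev ∘ g ∘ f = (Fin.rev ∘ g ∘ Fin.rev) ∘ (Fin.rev ∘ f) := flip (Fin.rev ∘ g)
      rw [this]
      exact hg.conj_rev.comp hf
    · exact Or.inr (IsCyclicMono.comp (g := Fin.rev ∘ g) hg hf)
    · refine Or.inl ?_
      have e : g ∘ Fin.rev = Fin.rev ∘ (Fin.rev ∘ g) ∘ Fin.rev := by
        calc g ∘ Fin.rev = id ∘ g ∘ Fin.rev := rfl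
          _ = _ := by rw [← rev_comp_rev]; rfl
      rw [flip g, e]
      exact hg.conj_rev.comp hf

/-- The objects `[n]`, `n` a positive integer, of the category of type `t`. -/
structure Obj (t : CameronType) where
  /-- The number of points. -/
  card : ℕ+

namespace Obj

variable {t : CameronType}

/-- The object `[n+1]` following `[n]`. -/
def next (n : Obj t) : Obj t := ⟨n.card + 1⟩

/-- The category `𝒞` of type `t`: morphisms `[m] → [n]` are the relation-preserving maps. -/
instance category : SmallCategory (Obj t) where
  Hom m n := {f : Fin m.card → Fin n.card // IsMor t f}
  id m := ⟨id, isMor_id t _⟩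
  comp f g := ⟨g.1 ∘ f.1, g.2.comp f.2⟩

end Obj

/-! ### Submodules, quotients, top and socle of functors to modules -/

/-- Modules over a category: covariant functors to `k`-modules. -/
abbrev CatMod (C : Type) [SmallCategory C] (k : Type u) [Field k] := C ⥤ ModuleCat.{u} k

section Submodules

variable {C : Type} [SmallCategory C] {k : Type u} [Field k]

/-- A submodule of a `C`-module. -/
@[ext]
structure Submod (V : CatMod C k) where
  /-- The value on each object. -/
  carrier : ∀ X : C, Submodule k (V.obj X)
  map_mem : ∀ {X Y : C} (f : X ⟶ Y), carrier X ≤ (carrier Y).comap (V.map f).hom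

namespace Submod

variable {V : CatMod C k}

instance : PartialOrder (Submod V) :=
  PartialOrder.lift (fun S => S.carrier) fun _ _ h => Submod.ext h

instance : InfSet (Submod V) where
  sInf s :=
    { carrier := fun X => ⨅ S ∈ s, S.carrier X
      map_mem := fun {X Y} f x hx => by
        simp only [Submodule.mem_comap, Submodule.mem_iInf] at hx ⊢
        exact fun S hS => S.map_mem f (hx S hS) }

/-- Submodules, ordered by inclusion, form a complete lattice. -/
instance : CompleteLattice (Submod V) :=
  completeLatticeOfInf (Submod V) fun _ =>
    ⟨fun S hS _ => iInf₂_le S hS, fun _ hT X => le_iInf₂ fun _ hS => hT hS X⟩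

/-- A submodule as a `C`-module. -/
def toMod (S : Submod V) : CatMod C k where
  obj X := ModuleCat.of k (S.carrier X)
  map f := ModuleCat.ofHom ((V.map f).hom.restrict (S.map_mem f))
  map_id X := by
    ext x
    exact congrArg (fun h => h.hom x.1) (V.map_id X)
  map_comp f g := by
    ext x
    exact congrArg (fun h => h.hom x.1) (V.map_comp f g)

/-- The quotient of a `C`-module by a submodule. -/
def quotient (S : Submod V) : CatMod C k where
  obj X := ModuleCat.of k (V.obj X ⧸ S.carrier X)
  map {X Y} f := ModuleCat.ofHom (Submodule.mapQ _ _ (V.map f).hom (S.map_mem f))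
  map_id X := by
    ext x
    exact congrArg (fun h => Submodule.Quotient.mk (p := S.carrier X) (h.hom x)) (V.map_id X)
  map_comp {X Y Z} f g := by
    ext x
    exact congrArg (fun h => Submodule.Quotient.mk (p := S.carrier Z) (h.hom x)) (V.map_comp f g)

end Submod

/-- The radical: the intersection of all maximal submodules. -/
def radical (V : CatMod C k) : Submod V := sInf {S | IsCoatom S}

/-- The top of `V`: the quotient of `V` by its radical. -/
def top (V : CatMod C k) : CatMod C k := (radical V).quotient

/-- The socle of `V`: the sum of all simple (that is, minimal nonzero) submodules. -/
def socle (V : CatMod C k) : CatMod C k := (sSup {S : Submod V | IsAtom S}).toMod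

end Submodules

/-! ### Isomorphism classes of irreducible objects -/

/-- Isomorphism classes of objects of a category. -/
abbrev IsoClass (D : Type*) [Category D] := Quotient (isIsomorphicSetoid D)

/-- The isomorphism class of an object. -/
def isoClass {D : Type*} [Category D] (X : D) : IsoClass D := Quotient.mk (isIsomorphicSetoid D) X

/-- `Irr(G)`: isomorphism classes of irreducible representations of `G` over `k`. -/
def Irr (k : Type u) [Field k] (G : Type) [Group G] :=
  {c : IsoClass (Rep.{u} k G) // ∃ l : Rep.{u} k G, l.ρ.IsIrreducible ∧ isoClass l = c}

/-- The element of `Irr(G)` given by an irreducible representation. -/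
def Irr.mk {k : Type u} [Field k] {G : Type} [Group G] (l : Rep.{u} k G)
    (hl : l.ρ.IsIrreducible) : Irr k G :=
  ⟨isoClass l, l, hl, rfl⟩

/-- Isomorphism classes of irreducible `C`-modules. -/
def IrrMod (C : Type) [SmallCategory C] (k : Type u) [Field k] :=
  {c : IsoClass (CatMod C k) // ∃ V : CatMod C k, Simple V ∧ isoClass V = c}

/-! ### Standard modules -/

section Standard

variable (k : Type u) [Field k] {t : CameronType}

/-- An element of `G_n = Aut [n]`, regarded as an isomorphism. -/
def autIso {n : Obj t} (g : Aut n) : n ≅ n := g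

/-- The representable module `P_n = k𝒞(n, -)`. -/
def P (n : Obj t) : CatMod (Obj t) k where
  obj m := ModuleCat.of k ((n ⟶ m) →₀ k)
  map f := ModuleCat.ofHom (Finsupp.lmapDomain k k (· ≫ f))
  map_id m := by ext; simp
  map_comp f g := by ext; simp

/-- The submodule of `P_n` spanned by the non-injective morphisms with source `[n]`. -/
def nonInj (n : Obj t) : Submod (P k n) where
  carrier m := Submodule.span k
    {x | ∃ f : n ⟶ m, ¬ Function.Injective f.1 ∧ x = (Finsupp.single f 1 : (n ⟶ m) →₀ k)}
  map_mem {m m'} g := by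
    rw [Submodule.span_le]
    rintro _ ⟨f, hf, rfl⟩
    refine Submodule.subset_span ⟨f ≫ g, fun h => hf (Function.Injective.of_comp h), ?_⟩
    exact Finsupp.mapDomain_single

/-- The standard module `Δ_n`. -/
def Delta (n : Obj t) : CatMod (Obj t) k := (nonInj k n).quotient

/-- The right action of `g ∈ G_n` on `Δ_n(m)`, induced by `f ↦ f ∘ g`. -/
def rightAct {n : Obj t} (g : Aut n) (m : Obj t) : (Delta k n).obj m →ₗ[k] (Delta k n).obj m :=
  Submodule.mapQ ((nonInj k n).carrier m) ((nonInj k n).carrier m)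
    (Finsupp.lmapDomain k k fun f : n ⟶ m => (autIso g).hom ≫ f) (by
      rw [nonInj, Submodule.span_le]
      rintro _ ⟨f, hf, rfl⟩
      refine Submodule.subset_span ⟨(autIso g).hom ≫ f, fun h => hf ?_, ?_⟩
      · have e : f.1 = ((autIso g).hom ≫ f).1 ∘ (autIso g).inv.1 := by
          have : f = (autIso g).inv ≫ (autIso g).hom ≫ f := (Iso.inv_hom_id_assoc (autIso g) f).symm
          exact congrArg Subtype.val this
        rw [e]
        refine h.comp (Function.LeftInverse.injective (g := (autIso g).hom.1) fun i => ?_)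
        exact congrFun (congrArg Subtype.val (Iso.inv_hom_id (autIso g))) i
      · exact Finsupp.mapDomain_single)

theorem map_rightAct {n m m' : Obj t} (g : Aut n) (f : m ⟶ m') (x : (Delta k n).obj m) :
    ((Delta k n).map f).hom (rightAct k g m x) = rightAct k g m' (((Delta k n).map f).hom x) := by
  obtain ⟨x, rfl⟩ := Submodule.Quotient.mk_surjective _ x
  refine congrArg (Submodule.Quotient.mk (p := (nonInj k n).carrier m')) ?_
  have key : ∀ y : (n ⟶ m) →₀ k,
      Finsupp.mapDomain (fun h : n ⟶ m => h ≫ f)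
        (Finsupp.mapDomain (fun h => (autIso g).hom ≫ h) y) =
      Finsupp.mapDomain (fun h => (autIso g).hom ≫ h)
        (Finsupp.mapDomain (fun h : n ⟶ m => h ≫ f) y) := fun y => by
    rw [← Finsupp.mapDomain_comp, ← Finsupp.mapDomain_comp]
    rfl
  exact key x

variable {k}

/-- `Δ_n ⊗_k λ`. -/
def tensorK {n : Obj t} (l : Rep.{u} k (Aut n)) : CatMod (Obj t) k where
  obj m := ModuleCat.of k ((Delta k n).obj m ⊗[k] l.V)
  map f := ModuleCat.ofHom (LinearMap.rTensor l.V ((Delta k n).map f).hom)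
  map_id m := by ext : 1; simp
  map_comp f g := by ext : 1; simp [LinearMap.rTensor_comp]

/-- The submodule of `Δ_n ⊗_k λ` spanned by the elements `x g ⊗ v - x ⊗ g v`, `g ∈ G_n`. -/
def balancing {n : Obj t} (l : Rep.{u} k (Aut n)) : Submod (tensorK l) where
  carrier m := Submodule.span k
    {z | ∃ (g : Aut n) (x : (Delta k n).obj m) (v : l.V),
      z = rightAct k g m x ⊗ₜ[k] v - x ⊗ₜ[k] l.ρ g v}
  map_mem {m m'} f := by
    rw [Submodule.span_le]
    rintro _ ⟨g, x, v, rfl⟩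
    refine Submodule.subset_span ⟨g, ((Delta k n).map f).hom x, v, ?_⟩
    change LinearMap.rTensor l.V ((Delta k n).map f).hom _ = _
    rw [map_sub, LinearMap.rTensor_tmul, LinearMap.rTensor_tmul, map_rightAct]

/-- The indecomposable standard module `Δ_{n,λ} = Δ_n ⊗_{kG_n} λ`. -/
def DeltaIrr {n : Obj t} (l : Rep.{u} k (Aut n)) : CatMod (Obj t) k := (balancing l).quotient

/-- `λ ∈ Irr(G_n)` is singular: there is a nonzero homomorphism `Δ_{n+1} → Δ_{n,λ}`.
Otherwise it is regular. -/
def IsSingular {n : Obj t} (l : Rep.{u} k (Aut n)) : Prop :=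
  ∃ φ : Delta k n.next ⟶ DeltaIrr l, φ ≠ 0

/-- `(λ, μ)`, with `λ ∈ Irr(G_{n+1})` and `μ ∈ Irr(G_n)`, is a pair of singular representations:
there is a nonzero homomorphism `Δ_{n+1,λ} → Δ_{n,μ}`. -/
def IsSingularPair {n : Obj t} (l : Rep.{u} k (Aut n.next)) (μ : Rep.{u} k (Aut n)) : Prop :=
  ∃ φ : DeltaIrr l ⟶ DeltaIrr μ, φ ≠ 0

/-- The self-map `s` of `[n]` is an automorphism and acts on `λ` as the scalar `c`. -/
def ActsBy {n : Obj t} (l : Rep.{u} k (Aut n)) (s : Fin n.card → Fin n.card) (c : k) : Prop :=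
  ∃ g : Aut n, (autIso g).hom.1 = s ∧ ∀ v : l.V, l.ρ g v = c • v

/-- The sign representation of the symmetric group (up to multiplicity): every permutation acts by
its sign. -/
def IsSign {n : Obj t} (l : Rep.{u} k (Aut n)) : Prop :=
  ∀ s : Equiv.Perm (Fin n.card), ActsBy l s ((Equiv.Perm.sign s : ℤ) : k)

/-- The explicit table of pairs `(λ, μ)`, `λ ∈ Irr(G_{n+1})`, `μ ∈ Irr(G_n)`, in terms of the
rotation `rot _ 1` and the reversal `Fin.rev`. -/
def SingularTable {t : CameronType} {n : Obj t} (l : Rep.{u} k (Aut n.next))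
    (μ : Rep.{u} k (Aut n)) : Prop :=
  match t with
  | .FA => IsSign l ∧ IsSign μ
  | .OA => True
  | .CA => ActsBy l (rot _ 1) ((-1) ^ (n.card : ℕ)) ∧ ActsBy μ (rot _ 1) ((-1) ^ ((n.card : ℕ) + 1))
  | .BA => ∃ ε : k, (ε = 1 ∨ ε = -1) ∧
      ActsBy l Fin.rev ε ∧ ActsBy μ Fin.rev ((-1) ^ (n.card : ℕ) * ε)
  | .SA => ActsBy l (rot _ 1) ((-1) ^ (n.card : ℕ)) ∧ ActsBy μ (rot _ 1) ((-1) ^ ((n.card : ℕ) + 1)) ∧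
      ∃ ε : k, (ε = 1 ∨ ε = -1) ∧
        ActsBy l Fin.rev ε ∧ ActsBy μ Fin.rev ((-1) ^ (n.card : ℕ) * ε)

end Standard

end

/-!
Every injective morphism of `𝒞` is, in a unique way, an automorphism of its source followed by a
strictly increasing map (`Obj.exists_aut_comp_monotone`, `Obj.aut_comp_strictMono_inj`). So
`Δ_{n,λ}([m])` is a direct sum of copies of `λ` indexed by the strictly increasing maps
`e : [n] → [m]`; the projections are the maps `DeltaIrr.coord`, and an element is determined by them
(`DeltaIrr.ext_coord`). This makes one argument serve all five categories.

The combinatorial core concerns the elements `x` of `Δ_{n,λ}([m])` killed by all degeneracies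
`[m] → [m-1]`. The degeneracy identifying `j` and `j+1` shows that the coordinate of `x` at `e`
vanishes if `e` avoids `j` and `j+1`, and changes sign if `e` takes the value `j` but not `j+1`
and `j` is replaced by `j+1`. If `m ≥ n+2`, then two points missed by `e` can be moved next to
each other, so `x = 0` (`DeltaIrr.eq_zero_of_merge`). If `m = n+1`, then `x` is an alternating sum
of faces `∑ (-1)^i d_i ⊗ v` (`DeltaIrr.eq_altSum_of_merge`).

A proper submodule of `Δ_{n,λ}` vanishes at `[n]`, because `λ` is irreducible and generates; so
there is a unique maximal submodule, and `Δ_{n,λ}` has a simple top. Every simple module arises in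
this way from a unique pair `(n,λ)`: `[n]` is the smallest object at which it does not vanish and
`λ` is its value there (`topClass_bijective`). The smallest object at which a proper nonzero
submodule of `Δ_{n,λ}` does not vanish can only be `[n+1]`, by the combinatorial core, and its
value there is killed by all non-injective morphisms (`DeltaIrr.exists_mem_killed`). If `λ` is
regular there are no such elements, and `Δ_{n,λ}` is simple. If `(λ,μ)` is a singular pair, then
`μ` has dimension one, so the alternating sums form a line in `Δ_{n,μ}([n+1])`; therefore the
image of `Δ_{n+1,λ}` is the smallest nonzero submodule of `Δ_{n,μ}`, that is, its socle
(`nonempty_top_iso_socle`).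

For the table, a homomorphism `Δ_{n+1,λ} → Δ_{n,μ}` amounts to a linear map `θ : λ → μ` for which
`u ↦ ∑ (-1)^i d_i ⊗ θ u` is equivariant (`DeltaIrr.exists_hom_ne_zero_iff`). It is enough to test
this on the rotation, the reversal and the exchanges of neighbours, where it is read off from the
identities `γ ∘ d_i = d_j ∘ h`; for example the rotation `σ` satisfies `σ ∘ d_n = d_0` and
`σ ∘ d_i = d_{i+1} ∘ σ` for `i < n`, which forces the two signs in the table.
-/

noncomputable section

/-! ### Submodules, simplicity and maps of modules over a category -/

section Generalities

variable {C : Type} [SmallCategory C] {k : Type u} [Field k]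

theorem CatMod.map_comp_apply (V : CatMod C k) {X Y Z : C} (f : X ⟶ Y) (g : Y ⟶ Z)
    (x : V.obj X) : (V.map (f ≫ g)).hom x = (V.map g).hom ((V.map f).hom x) := by
  rw [V.map_comp]; rfl

theorem CatMod.map_id_apply (V : CatMod C k) {X : C} (x : V.obj X) :
    (V.map (𝟙 X)).hom x = x := by
  rw [V.map_id]; rfl

theorem CatMod.naturality_apply {V W : CatMod C k} (φ : V ⟶ W) {X Y : C} (f : X ⟶ Y)
    (x : V.obj X) : (φ.app Y).hom ((V.map f).hom x) = (W.map f).hom ((φ.app X).hom x) :=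
  congrArg (fun h => h.hom x) (φ.naturality f)

theorem CatMod.exists_ne_zero_of_hom_ne_zero {V W : CatMod C k} {φ : V ⟶ W} (h : φ ≠ 0) :
    ∃ (X : C) (x : V.obj X), (φ.app X).hom x ≠ 0 := by
  by_contra! H
  refine h ?_
  ext X x
  exact H X x

namespace Submod

variable {V W : CatMod C k}

theorem carrier_bot (X : C) : (⊥ : Submod V).carrier X = ⊥ := by
  let Z : Submod V := ⟨fun _ => ⊥, fun f => by simp⟩
  exact le_bot_iff.1 ((bot_le : (⊥ : Submod V) ≤ Z) X)

theorem carrier_top (X : C) : (⊤ : Submod V).carrier X = ⊤ := by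
  let Z : Submod V := ⟨fun _ => ⊤, fun f => by simp⟩
  exact top_le_iff.1 ((le_top : Z ≤ (⊤ : Submod V)) X)

theorem eq_bot_iff_carrier {S : Submod V} : S = ⊥ ↔ ∀ X, S.carrier X = ⊥ :=
  ⟨fun h X => by rw [h, carrier_bot], fun h => by ext X : 2; rw [h, carrier_bot]⟩

theorem eq_top_iff_carrier {S : Submod V} : S = ⊤ ↔ ∀ X, S.carrier X = ⊤ :=
  ⟨fun h X => by rw [h, carrier_top], fun h => by ext X : 2; rw [h, carrier_top]⟩

theorem exists_ne_zero_of_ne_bot {S : Submod V} (h : S ≠ ⊥) :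
    ∃ X, ∃ x ∈ S.carrier X, x ≠ 0 := by
  by_contra! H
  exact h (eq_bot_iff_carrier.2 fun X => (Submodule.eq_bot_iff _).2 (H X))

/-- The inclusion of a submodule. -/
def incl (S : Submod V) : S.toMod ⟶ V where
  app X := ModuleCat.ofHom (S.carrier X).subtype
  naturality _ _ _ := rfl

/-- The image of a homomorphism of modules over a category. -/
def range (φ : V ⟶ W) : Submod W where
  carrier X := LinearMap.range (φ.app X).hom
  map_mem {X Y} f := by
    rintro _ ⟨x, rfl⟩
    exact ⟨(V.map f).hom x, CatMod.naturality_apply φ f x⟩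

/-- The preimage of a submodule under a homomorphism of modules over a category. -/
def comap (φ : V ⟶ W) (S : Submod W) : Submod V where
  carrier X := (S.carrier X).comap (φ.app X).hom
  map_mem {X Y} f x hx := by
    rw [Submodule.mem_comap, Submodule.mem_comap, CatMod.naturality_apply]
    exact S.map_mem f hx

/-- A homomorphism with values in a submodule, as a homomorphism to that submodule. -/
def codRestrict (S : Submod W) (φ : V ⟶ W) (h : ∀ X x, (φ.app X).hom x ∈ S.carrier X) :
    V ⟶ S.toMod where
  app X := ModuleCat.ofHom ((φ.app X).hom.codRestrict (S.carrier X) (h X))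
  naturality X Y f := by
    ext x
    exact Subtype.ext (CatMod.naturality_apply φ f x)

/-- The projection to a quotient. -/
def proj (S : Submod V) : V ⟶ S.quotient where
  app X := ModuleCat.ofHom (S.carrier X).mkQ
  naturality _ _ _ := rfl

/-- The homomorphism induced on a quotient. -/
def lift (S : Submod V) (φ : V ⟶ W) (h : ∀ X, ∀ x ∈ S.carrier X, (φ.app X).hom x = 0) :
    S.quotient ⟶ W where
  app X := ModuleCat.ofHom ((S.carrier X).liftQ (φ.app X).hom fun x hx => h X x hx)
  naturality X Y f := by
    ext x
    obtain ⟨x, rfl⟩ := Submodule.Quotient.mk_surjective _ x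
    exact CatMod.naturality_apply φ f x

theorem proj_surjective (S : Submod V) (X : C) : Function.Surjective (S.proj.app X).hom :=
  Submodule.mkQ_surjective _

theorem proj_eq_zero_iff (S : Submod V) {X : C} {x : V.obj X} :
    (S.proj.app X).hom x = 0 ↔ x ∈ S.carrier X :=
  Submodule.Quotient.mk_eq_zero _

/-- The largest submodule whose value at `X` lies in an `End X`-stable subspace `N`: an element
`y` belongs to it when every morphism to `X` sends `y` into `N`. -/
def colon (V : CatMod C k) (X : C) (N : Submodule k (V.obj X)) : Submod V where
  carrier Y := ⨅ f : Y ⟶ X, N.comap (V.map f).hom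
  map_mem {Y Z} g y hy := by
    simp only [Submodule.mem_comap, Submodule.mem_iInf] at hy ⊢
    intro f
    rw [← CatMod.map_comp_apply]
    exact hy (g ≫ f)

theorem mem_colon {X Y : C} {N : Submodule k (V.obj X)} {y : V.obj Y} :
    y ∈ (colon V X N).carrier Y ↔ ∀ f : Y ⟶ X, (V.map f).hom y ∈ N := by
  simp [colon]

end Submod

theorem CatMod.nonempty_iso_of_bijective {V W : CatMod C k} (φ : V ⟶ W)
    (h : ∀ X, Function.Bijective (φ.app X).hom) : Nonempty (V ≅ W) := by
  have (X : C) : IsIso (φ.app X) := (ConcreteCategory.isIso_iff_bijective (φ.app X)).2 (h X)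
  have := NatIso.isIso_of_isIso_app φ
  exact ⟨asIso φ⟩

theorem CatMod.bijective_of_iso {V W : CatMod C k} (e : V ≅ W) (X : C) :
    Function.Bijective (e.hom.app X).hom :=
  (ConcreteCategory.isIso_iff_bijective (e.hom.app X)).1 inferInstance

theorem CatMod.injective_of_mono {V W : CatMod C k} (φ : V ⟶ W) [Mono φ] (X : C) :
    Function.Injective (φ.app X).hom :=
  (ModuleCat.mono_iff_injective (φ.app X)).1 inferInstance

/-- A module over a category is simple as an object if and only if it is nonzero and has no
proper nonzero submodule. -/
theorem CatMod.simple_iff {V : CatMod C k} :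
    Simple V ↔ (∃ (X : C) (x : V.obj X), x ≠ 0) ∧ ∀ S : Submod V, S = ⊥ ∨ S = ⊤ := by
  constructor
  · intro hV
    constructor
    · by_contra! H
      refine id_nonzero V ?_
      ext X x
      exact H X x
    · intro S
      have : Mono S.incl := by
        have (X : C) : Mono (S.incl.app X) :=
          (ModuleCat.mono_iff_injective _).2 (Submodule.injective_subtype _)
        exact NatTrans.mono_of_mono_app _
      by_cases h : S.incl = 0
      · left
        refine Submod.eq_bot_iff_carrier.2 fun X => (Submodule.eq_bot_iff _).2 fun x hx => ?_
        have := congrArg (fun φ : S.toMod ⟶ V => (φ.app X).hom (⟨x, hx⟩ : S.carrier X)) h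
        exact this
      · right
        have := isIso_of_mono_of_nonzero h
        refine Submod.eq_top_iff_carrier.2 fun X => Submodule.eq_top_iff'.2 fun x => ?_
        obtain ⟨y, hy⟩ := (CatMod.bijective_of_iso (asIso S.incl) X).2 x
        rw [← hy]
        exact y.2
  · rintro ⟨⟨X, x, hx⟩, H⟩
    refine ⟨fun {W} f hf => ⟨fun hi h0 => ?_, fun h0 => ?_⟩⟩
    · obtain ⟨y, hy⟩ := (CatMod.bijective_of_iso (asIso f) X).2 x
      refine hx ?_
      rw [← hy]
      change (f.app X).hom y = 0
      rw [h0]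
      rfl
    · rcases H (Submod.range f) with h | h
      · refine absurd ?_ h0
        ext Y y
        have : (f.app Y).hom y ∈ (Submod.range f).carrier Y := ⟨y, rfl⟩
        rw [h, Submod.carrier_bot] at this
        exact this
      · have (Y : C) : IsIso (f.app Y) := by
          refine (ConcreteCategory.isIso_iff_bijective (f.app Y)).2
            ⟨CatMod.injective_of_mono f Y, fun y => ?_⟩
          have : y ∈ (Submod.range f).carrier Y := by rw [h, Submod.carrier_top]; trivial
          exact this
        exact NatIso.isIso_of_isIso_app f

/-- A minimal nonzero submodule is a simple module. -/
theorem Submod.simple_toMod {V : CatMod C k} {S : Submod V} (hS : IsAtom S) : Simple S.toMod := by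
  rw [CatMod.simple_iff]
  constructor
  · obtain ⟨X, x, hx, h0⟩ := Submod.exists_ne_zero_of_ne_bot hS.1
    exact ⟨X, ⟨x, hx⟩, fun h => h0 (congrArg Subtype.val h)⟩
  · intro T
    let T' : Submod V :=
      { carrier := fun X => (T.carrier X).map (S.carrier X).subtype
        map_mem := fun {X Y} f => by
          rintro _ ⟨x, hx, rfl⟩
          exact ⟨(S.toMod.map f).hom x, T.map_mem f hx, rfl⟩ }
    have hT' : T' ≤ S := fun X => by
      rintro _ ⟨x, -, rfl⟩
      exact x.2
    rcases hS.le_iff.1 hT' with h | h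
    · left
      refine Submod.eq_bot_iff_carrier.2 fun X => (Submodule.eq_bot_iff _).2 fun x hx => ?_
      have : x.1 ∈ T'.carrier X := ⟨x, hx, rfl⟩
      rw [h, Submod.carrier_bot] at this
      exact Subtype.ext this
    · right
      refine Submod.eq_top_iff_carrier.2 fun X => Submodule.eq_top_iff'.2 fun x => ?_
      have : x.1 ∈ T'.carrier X := by rw [h]; exact x.2
      obtain ⟨y, hy, hyx⟩ := this
      rwa [← Subtype.ext hyx]

/-- The quotient by a maximal submodule is simple. -/
theorem Submod.simple_quotient {V : CatMod C k} {M : Submod V} (hM : IsCoatom M) :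
    Simple M.quotient := by
  rw [CatMod.simple_iff]
  constructor
  · by_contra! H
    refine hM.1 (Submod.eq_top_iff_carrier.2 fun X => Submodule.eq_top_iff'.2 fun x => ?_)
    exact (M.proj_eq_zero_iff).1 (H X _)
  · intro T
    have hle : M ≤ Submod.comap M.proj T := fun X x hx => by
      change (M.proj.app X).hom x ∈ T.carrier X
      rw [(M.proj_eq_zero_iff).2 hx]
      exact zero_mem _
    rcases hM.le_iff.1 hle with h | h
    · right
      refine Submod.eq_top_iff_carrier.2 fun X => Submodule.eq_top_iff'.2 fun x => ?_
      obtain ⟨x, rfl⟩ := M.proj_surjective X x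
      have : x ∈ (Submod.comap M.proj T).carrier X := by rw [h, Submod.carrier_top]; trivial
      exact this
    · left
      refine Submod.eq_bot_iff_carrier.2 fun X => (Submodule.eq_bot_iff _).2 fun x hx => ?_
      obtain ⟨x, rfl⟩ := M.proj_surjective X x
      refine (M.proj_eq_zero_iff).2 ?_
      rw [← h]
      exact hx

end Generalities

/-! ### Morphisms: automorphisms followed by monotone maps -/

section Morphisms

variable {t : CameronType}

theorem IsMor.of_monotone {m n : ℕ} {f : Fin m → Fin n} (hf : Monotone f) : IsMor t f := by
  have h : IsCyclicMono f := ⟨0, by rwa [rot_zero]⟩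
  cases t
  · trivial
  · exact hf
  · exact h
  · exact Or.inl hf
  · exact Or.inl h

theorem rot_val {n r : ℕ} (i : Fin n) (hr : r ≤ n) :
    (rot n r i : ℕ) = if (i : ℕ) + r < n then i + r else i + r - n := by
  have := i.isLt
  split_ifs with h
  · exact Nat.mod_eq_of_lt h
  · change (i + r) % n = _
    rw [Nat.mod_eq_sub_mod (by omega), Nat.mod_eq_of_lt (by omega)]

theorem rot_mod (n r : ℕ) : rot n (r % n) = rot n r := by
  funext i
  exact Fin.ext (Nat.add_mod_mod _ _ _)

theorem rot_comp_rot_sub (n r : ℕ) : rot n r ∘ rot n (n - r % n) = id := by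
  rw [← rot_mod n r]
  funext i
  have hr := Nat.mod_lt r (Nat.zero_lt_of_lt i.isLt)
  have hi := i.isLt
  apply Fin.ext
  simp only [Function.comp_apply, id_eq]
  rw [rot_val _ hr.le, rot_val _ (Nat.sub_le _ _)]
  split_ifs <;> omega

theorem rot_sub_comp_rot (n r : ℕ) : rot n (n - r % n) ∘ rot n r = id := by
  rw [rot_comp, Nat.add_comm, ← rot_comp, rot_comp_rot_sub]

theorem isCyclicMono_rot (n r : ℕ) : IsCyclicMono (rot n r) :=
  ⟨n - r % n, by rw [rot_comp_rot_sub]; exact monotone_id⟩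

theorem isCyclicAnti_rev (n : ℕ) : IsCyclicAnti (Fin.rev : Fin n → Fin n) :=
  ⟨0, by rw [rot_zero]; exact fun i j h => Fin.rev_le_rev.2 h⟩

/-- A monotone injective self-map of `[n]` is the identity. -/
theorem eq_id_of_strictMono {n : ℕ} {f : Fin n → Fin n} (hf : StrictMono f) : f = id :=
  (hf.range_inj strictMono_id).1 <| by
    rw [Set.range_id, (Finite.surjective_of_injective hf.injective).range_eq]

namespace Obj

variable {n m p : Obj t}

theorem hom_ext {f g : n ⟶ m} (h : f.1 = g.1) : f = g := Subtype.ext h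

theorem comp_val (f : n ⟶ m) (g : m ⟶ p) : (f ≫ g).1 = g.1 ∘ f.1 := rfl

/-- A monotone map as a morphism. -/
def ofMono (f : Fin n.card → Fin m.card) (hf : Monotone f) : n ⟶ m := ⟨f, IsMor.of_monotone hf⟩

/-- The automorphism given by two mutually inverse relation-preserving maps. -/
def mkAut (s s' : Fin n.card → Fin n.card) (hs : IsMor t s) (hs' : IsMor t s')
    (h : s' ∘ s = id) (h' : s ∘ s' = id) : Aut n :=
  show n ≅ n from
  { hom := ⟨s, hs⟩
    inv := ⟨s', hs'⟩
    hom_inv_id := Subtype.ext h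
    inv_hom_id := Subtype.ext h' }

theorem aut_one : (autIso (1 : Aut n)).hom = 𝟙 n := rfl

theorem aut_mul (g h : Aut n) : (autIso (g * h)).hom = (autIso h).hom ≫ (autIso g).hom := rfl

theorem aut_ext {g h : Aut n} (H : (autIso g).hom.1 = (autIso h).hom.1) : g = h :=
  Aut.ext (Subtype.ext H)

theorem aut_inv_comp_hom (g : Aut n) : (autIso g).inv.1 ∘ (autIso g).hom.1 = id :=
  congrArg Subtype.val (autIso g).hom_inv_id

theorem aut_hom_comp_inv (g : Aut n) : (autIso g).hom.1 ∘ (autIso g).inv.1 = id :=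
  congrArg Subtype.val (autIso g).inv_hom_id

theorem aut_injective (g : Aut n) : Function.Injective (autIso g).hom.1 :=
  Function.LeftInverse.injective (congrFun (aut_inv_comp_hom g))

theorem aut_surjective (g : Aut n) : Function.Surjective (autIso g).hom.1 :=
  Function.RightInverse.surjective (congrFun (aut_hom_comp_inv g))

instance : Finite (Aut n) :=
  Finite.of_injective (fun g => (autIso g).hom.1) fun _ _ => aut_ext

instance : Fintype (Aut n) := Fintype.ofFinite _

instance : Finite (n ⟶ m) := Finite.of_injective (fun f => f.1) fun _ _ => hom_ext

theorem exists_aut_comp_of_monotone (f : n ⟶ m) (s s' : Fin n.card → Fin n.card)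
    (hs : IsMor t s) (hs' : IsMor t s') (h : s' ∘ s = id) (h' : s ∘ s' = id)
    (hf : Monotone (f.1 ∘ s)) :
    ∃ (g : Aut n) (e : n ⟶ m), Monotone e.1 ∧ f = (autIso g).hom ≫ e :=
  ⟨mkAut s' s hs' hs h' h, ⟨f.1 ∘ s, IsMor.of_monotone hf⟩, hf, hom_ext <|
    show f.1 = f.1 ∘ (s ∘ s') by rw [h']; rfl⟩

/-- Every morphism is an automorphism followed by a monotone map. Hence the restriction of `Δ_n`
to monotone maps is a direct sum of copies, indexed by `G_n`, of the corresponding module of the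
category of monotone maps. -/
theorem exists_aut_comp_monotone (f : n ⟶ m) :
    ∃ (g : Aut n) (e : n ⟶ m), Monotone e.1 ∧ f = (autIso g).hom ≫ e := by
  obtain ⟨f, hf⟩ := f
  have hrev : ∀ {s : Fin n.card → Fin m.card}, Antitone s → Monotone (s ∘ Fin.rev) :=
    fun hs i j hij => hs (Fin.rev_le_rev.2 hij)
  cases t with
  | FA =>
    exact exists_aut_comp_of_monotone _ (Tuple.sort f) (Tuple.sort f).symm trivial trivial
      (by simp) (by simp) (Tuple.monotone_sort f)
  | OA => exact exists_aut_comp_of_monotone _ id id (isMor_id _ _) (isMor_id _ _) rfl rfl hf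
  | CA =>
    obtain ⟨r, hr⟩ := hf
    exact exists_aut_comp_of_monotone _ (rot _ r) (rot _ (_ - r % _)) (isCyclicMono_rot _ _)
      (isCyclicMono_rot _ _) (rot_sub_comp_rot _ _) (rot_comp_rot_sub _ _) hr
  | BA =>
    rcases hf with hf | hf
    · exact exists_aut_comp_of_monotone _ id id (isMor_id _ _) (isMor_id _ _) rfl rfl hf
    · exact exists_aut_comp_of_monotone _ Fin.rev Fin.rev
        (Or.inr fun i j h => Fin.rev_le_rev.2 h) (Or.inr fun i j h => Fin.rev_le_rev.2 h)
        (rev_comp_rev _) (rev_comp_rev _) (hrev hf)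
  | SA =>
    rcases hf with ⟨r, hr⟩ | ⟨r, hr⟩
    · exact exists_aut_comp_of_monotone _ (rot _ r) (rot _ (_ - r % _))
        (Or.inl (isCyclicMono_rot _ _)) (Or.inl (isCyclicMono_rot _ _)) (rot_sub_comp_rot _ _)
        (rot_comp_rot_sub _ _) hr
    · refine exists_aut_comp_of_monotone _ (rot _ r ∘ Fin.rev)
        (Fin.rev ∘ rot _ (n.card - r % n.card))
        (IsMor.comp (t := .SA) (Or.inl (isCyclicMono_rot _ _)) (Or.inr (isCyclicAnti_rev _)))
        (IsMor.comp (t := .SA) (Or.inr (isCyclicAnti_rev _)) (Or.inl (isCyclicMono_rot _ _)))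
        ?_ ?_ (hrev hr)
      · funext i
        have := congrFun (rot_sub_comp_rot n.card r) i.rev
        simp only [Function.comp_apply, id_eq] at this ⊢
        rw [this, Fin.rev_rev]
      · funext i
        have := congrFun (rot_comp_rot_sub n.card r) i
        simpa using this

/-- A factorization into an automorphism and a strictly monotone map is unique. -/
theorem aut_comp_strictMono_inj {g g' : Aut n} {e e' : n ⟶ m} (he : StrictMono e.1)
    (he' : StrictMono e'.1) (h : (autIso g).hom ≫ e = (autIso g').hom ≫ e') :
    g = g' ∧ e = e' := by
  have h1 : e.1 ∘ (autIso g).hom.1 = e'.1 ∘ (autIso g').hom.1 := congrArg Subtype.val h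
  have h2 : e = e' := by
    refine hom_ext ((he.range_inj he').1 ?_)
    rw [← (aut_surjective g).range_comp, h1, (aut_surjective g').range_comp]
  subst h2
  exact ⟨aut_ext (he.injective.comp_left h1), rfl⟩

theorem aut_comp_injective {g : Aut n} {e : n ⟶ m} (h : Function.Injective ((autIso g).hom ≫ e).1) :
    Function.Injective e.1 := by
  rw [← Function.Injective.of_comp_iff' e.1 ⟨aut_injective g, aut_surjective g⟩]
  exact h

theorem card_le_of_injective (f : n ⟶ m) (h : Function.Injective f.1) :
    (n.card : ℕ) ≤ m.card := by
  simpa using Fintype.card_le_of_injective f.1 h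

/-- An injective endomorphism is an automorphism. -/
theorem exists_aut_of_injective (f : n ⟶ n) (h : Function.Injective f.1) :
    ∃ g : Aut n, f = (autIso g).hom := by
  obtain ⟨g, e, he, rfl⟩ := exists_aut_comp_monotone f
  have : e = 𝟙 n :=
    hom_ext (eq_id_of_strictMono (he.strictMono_of_injective (aut_comp_injective h)))
  exact ⟨g, by rw [this, Category.comp_id]⟩

end Obj

end Morphisms

/-! ### The standard modules: generators, coordinates, universal properties -/

section StandardModules

variable {k : Type u} [Field k] {t : CameronType} {n m p : Obj t}

namespace Delta

/-- The class in `Δ_n(m)` of a linear combination of morphisms. -/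
def mkL : ((n ⟶ m) →₀ k) →ₗ[k] (Delta k n).obj m := ((nonInj k n).carrier m).mkQ

theorem mkL_surjective : Function.Surjective (mkL (k := k) (n := n) (m := m)) :=
  Submodule.mkQ_surjective ((nonInj k n).carrier m)

/-- The class in `Δ_n(m)` of a morphism. -/
def cls (f : n ⟶ m) : (Delta k n).obj m := mkL (Finsupp.single f 1)

theorem map_cls (f : n ⟶ m) (g : m ⟶ p) :
    ((Delta k n).map g).hom (cls f) = cls (f ≫ g) :=
  congrArg (Submodule.Quotient.mk (p := (nonInj k n).carrier p)) Finsupp.mapDomain_single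

theorem cls_eq_zero (f : n ⟶ m) (hf : ¬ Function.Injective f.1) :
    (cls f : (Delta k n).obj m) = 0 :=
  (Submodule.Quotient.mk_eq_zero _).2 (Submodule.subset_span ⟨f, hf, rfl⟩)

theorem rightAct_cls (g : Aut n) (f : n ⟶ m) :
    rightAct k g m (cls f) = cls ((autIso g).hom ≫ f) :=
  congrArg (Submodule.Quotient.mk (p := (nonInj k n).carrier m)) Finsupp.mapDomain_single

variable {W : Type*} [AddCommGroup W] [Module k W]

theorem lhom_ext {φ ψ : (Delta k n).obj m →ₗ[k] W} (h : ∀ f, φ (cls f) = ψ (cls f)) : φ = ψ := by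
  have key : φ ∘ₗ mkL = ψ ∘ₗ mkL := Finsupp.lhom_ext' fun f => LinearMap.ext_ring (h f)
  refine LinearMap.ext fun x => ?_
  obtain ⟨x, rfl⟩ := mkL_surjective x
  exact congrArg (fun L => L x) key

/-- The linear map on `Δ_n(m)` with prescribed values on the injective morphisms. -/
def liftL (F : (n ⟶ m) → W) (hF : ∀ f, ¬ Function.Injective f.1 → F f = 0) :
    (Delta k n).obj m →ₗ[k] W :=
  ((nonInj k n).carrier m).liftQ (Finsupp.linearCombination k F) <| Submodule.span_le.2 <| by
    rintro _ ⟨f, hf, rfl⟩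
    exact ((Finsupp.linearCombination_single k 1 f).trans (one_smul k _)).trans (hF f hf)

theorem liftL_cls (F : (n ⟶ m) → W) (hF : ∀ f, ¬ Function.Injective f.1 → F f = 0) (f : n ⟶ m) :
    liftL (k := k) F hF (cls f) = F f :=
  (Finsupp.linearCombination_single k 1 f).trans (one_smul k _)

variable {V : CatMod (Obj t) k}

/-- The homomorphism `Δ_n → V` given by an element of `V(n)` killed by all non-injective
morphisms. -/
def desc (x : V.obj n)
    (hx : ∀ (m : Obj t) (f : n ⟶ m), ¬ Function.Injective f.1 → (V.map f).hom x = 0) :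
    Delta k n ⟶ V where
  app m := ModuleCat.ofHom (liftL (fun f : n ⟶ m => (V.map f).hom x) (hx m))
  naturality m m' g := by
    refine ModuleCat.hom_ext (lhom_ext fun f => ?_)
    change liftL _ (hx m') (((Delta k n).map g).hom (cls f)) =
      (V.map g).hom (liftL _ (hx m) (cls f))
    rw [map_cls, liftL_cls, liftL_cls, CatMod.map_comp_apply]

theorem desc_cls (x : V.obj n)
    (hx : ∀ (m : Obj t) (f : n ⟶ m), ¬ Function.Injective f.1 → (V.map f).hom x = 0)
    (f : n ⟶ m) : ((desc x hx).app m).hom (cls f) = (V.map f).hom x :=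
  liftL_cls _ (hx m) f

theorem hom_ext {φ ψ : Delta k n ⟶ V}
    (h : (φ.app n).hom (cls (𝟙 n)) = (ψ.app n).hom (cls (𝟙 n))) : φ = ψ := by
  refine NatTrans.ext (funext fun m => ModuleCat.hom_ext (lhom_ext fun f => ?_))
  rw [← Category.id_comp f, ← map_cls, CatMod.naturality_apply, CatMod.naturality_apply, h]

end Delta

namespace DeltaIrr

variable {l : Rep.{u} k (Aut n)}

variable (l) in
/-- The projection `Δ_n(m) ⊗ λ → Δ_{n,λ}(m)`. -/
def mkL (m : Obj t) : ((Delta k n).obj m ⊗[k] l.V) →ₗ[k] (DeltaIrr l).obj m :=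
  ((balancing l).carrier m).mkQ

theorem mkL_surjective : Function.Surjective (mkL l m) :=
  Submodule.mkQ_surjective ((balancing l).carrier m)

variable (l) in
/-- The class `f ⊗ v` in `Δ_{n,λ}(m)`, as a linear function of `v ∈ λ`. -/
def gen (f : n ⟶ m) : l.V →ₗ[k] (DeltaIrr l).obj m :=
  mkL l m ∘ₗ TensorProduct.mk k _ _ (Delta.cls f)

theorem map_gen (f : n ⟶ m) (g : m ⟶ p) (v : l.V) :
    ((DeltaIrr l).map g).hom (gen l f v) = gen l (f ≫ g) v := by
  change mkL l p (((Delta k n).map g).hom (Delta.cls f) ⊗ₜ[k] v) = _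
  rw [Delta.map_cls]
  rfl

theorem gen_aut_comp (g : Aut n) (f : n ⟶ m) (v : l.V) :
    gen l ((autIso g).hom ≫ f) v = gen l f (l.ρ g v) := by
  refine (Submodule.Quotient.eq _).2 (Submodule.subset_span ⟨g, Delta.cls f, v, ?_⟩)
  rw [Delta.rightAct_cls]
  rfl

theorem gen_eq_zero (f : n ⟶ m) (hf : ¬ Function.Injective f.1) (v : l.V) : gen l f v = 0 := by
  change mkL l m (Delta.cls f ⊗ₜ[k] v) = 0
  rw [Delta.cls_eq_zero f hf, TensorProduct.zero_tmul, map_zero]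

section Lift

variable {W : Type*} [AddCommGroup W] [Module k W]

theorem lhom_ext {φ ψ : (DeltaIrr l).obj m →ₗ[k] W}
    (h : ∀ f v, φ (gen l f v) = ψ (gen l f v)) : φ = ψ := by
  have key : φ ∘ₗ mkL l m = ψ ∘ₗ mkL l m :=
    TensorProduct.ext (Delta.lhom_ext fun f => LinearMap.ext (h f))
  refine LinearMap.ext fun x => ?_
  obtain ⟨x, rfl⟩ := mkL_surjective x
  exact congrArg (fun L => L x) key

/-- The linear map on `Δ_{n,λ}(m)` with prescribed values on the elements `f ⊗ v`. -/
def liftL (B : (n ⟶ m) → l.V →ₗ[k] W) (h0 : ∀ f, ¬ Function.Injective f.1 → B f = 0)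
    (hB : ∀ (g : Aut n) f v, B ((autIso g).hom ≫ f) v = B f (l.ρ g v)) :
    (DeltaIrr l).obj m →ₗ[k] W :=
  ((balancing l).carrier m).liftQ (TensorProduct.lift (Delta.liftL B h0)) <|
    Submodule.span_le.2 <| by
      rintro _ ⟨g, x, v, rfl⟩
      have key : (Delta.liftL (k := k) B h0).flip v ∘ₗ rightAct k g m =
          (Delta.liftL (k := k) B h0).flip (l.ρ g v) := by
        refine Delta.lhom_ext fun f => ?_
        change Delta.liftL (k := k) B h0 (rightAct k g m (Delta.cls f)) v =
          Delta.liftL (k := k) B h0 (Delta.cls f) (l.ρ g v)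
        rw [Delta.rightAct_cls, Delta.liftL_cls, Delta.liftL_cls, hB]
      have := congrArg (fun L => L x) key
      exact ((TensorProduct.lift (Delta.liftL B h0)).map_sub _ _).trans (sub_eq_zero.2 this)

theorem liftL_gen (B : (n ⟶ m) → l.V →ₗ[k] W) (h0 : ∀ f, ¬ Function.Injective f.1 → B f = 0)
    (hB : ∀ (g : Aut n) f v, B ((autIso g).hom ≫ f) v = B f (l.ρ g v)) (f : n ⟶ m) (v : l.V) :
    liftL B h0 hB (gen l f v) = B f v :=
  congrArg (fun L => L v) (Delta.liftL_cls B h0 f)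

end Lift

theorem desc_balanced {V : CatMod (Obj t) k} (ψ : l.V →ₗ[k] V.obj n)
    (hψ : ∀ g v, ψ (l.ρ g v) = (V.map (autIso g).hom).hom (ψ v)) (g : Aut n) (f : n ⟶ m)
    (v : l.V) : ((V.map ((autIso g).hom ≫ f)).hom ∘ₗ ψ) v = ((V.map f).hom ∘ₗ ψ) (l.ρ g v) := by
  rw [LinearMap.comp_apply, LinearMap.comp_apply, CatMod.map_comp_apply, hψ]

/-- The homomorphism `Δ_{n,λ} → V` given by an equivariant map `λ → V(n)` whose values are killed
by all non-injective morphisms. -/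
def desc {V : CatMod (Obj t) k} (ψ : l.V →ₗ[k] V.obj n)
    (hψ : ∀ g v, ψ (l.ρ g v) = (V.map (autIso g).hom).hom (ψ v))
    (h0 : ∀ (m : Obj t) (f : n ⟶ m), ¬ Function.Injective f.1 → ∀ v, (V.map f).hom (ψ v) = 0) :
    DeltaIrr l ⟶ V where
  app m := ModuleCat.ofHom <| liftL (fun f : n ⟶ m => (V.map f).hom ∘ₗ ψ)
    (fun f hf => LinearMap.ext (h0 m f hf)) (desc_balanced ψ hψ)
  naturality m m' g := by
    refine ModuleCat.hom_ext (lhom_ext fun f v => ?_)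
    change liftL _ _ (desc_balanced ψ hψ) (((DeltaIrr l).map g).hom (gen l f v)) =
      (V.map g).hom (liftL _ _ (desc_balanced ψ hψ) (gen l f v))
    rw [map_gen, liftL_gen, liftL_gen]
    exact CatMod.map_comp_apply V f g (ψ v)

theorem desc_gen {V : CatMod (Obj t) k} (ψ : l.V →ₗ[k] V.obj n)
    (hψ : ∀ g v, ψ (l.ρ g v) = (V.map (autIso g).hom).hom (ψ v))
    (h0 : ∀ (m : Obj t) (f : n ⟶ m), ¬ Function.Injective f.1 → ∀ v, (V.map f).hom (ψ v) = 0)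
    (f : n ⟶ m) (v : l.V) :
    ((desc ψ hψ h0).app m).hom (gen l f v) = (V.map f).hom (ψ v) :=
  liftL_gen _ _ (desc_balanced ψ hψ) f v

theorem hom_ext {V : CatMod (Obj t) k} {φ ψ : DeltaIrr l ⟶ V}
    (h : ∀ v, (φ.app n).hom (gen l (𝟙 n) v) = (ψ.app n).hom (gen l (𝟙 n) v)) : φ = ψ := by
  refine NatTrans.ext (funext fun m => ModuleCat.hom_ext (lhom_ext fun f v => ?_))
  rw [← Category.id_comp f, ← map_gen, CatMod.naturality_apply, CatMod.naturality_apply, h]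

open Classical in
/-- The coordinate of an element of `Δ_{n,λ}(m)` at an injective morphism `e`: the element
`f ⊗ v` has coordinate `g v` if `f = e ∘ g` with `g ∈ G_n`, and coordinate `0` if there is no
such `g`. -/
def coord (e : n ⟶ m) (he : Function.Injective e.1) : (DeltaIrr l).obj m →ₗ[k] l.V :=
  liftL (fun f => ∑ g : Aut n, if f = (autIso g).hom ≫ e then l.ρ g else 0)
    (fun f hf => Finset.sum_eq_zero fun g _ => if_neg fun h => hf (by
      rw [h]
      exact he.comp (Obj.aut_injective g)))
    (fun h f v => by
      rw [← Equiv.sum_comp (Equiv.mulRight h)]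
      simp only [LinearMap.sum_apply]
      refine Finset.sum_congr rfl fun g _ => ?_
      rw [Equiv.coe_mulRight, Obj.aut_mul, Category.assoc]
      by_cases H : f = (autIso g).hom ≫ e
      · rw [if_pos (by rw [H]), if_pos H, map_mul]
        rfl
      · rw [if_neg fun h' => H ((cancel_epi _).1 h'), if_neg H]
        rfl)

open Classical in
theorem coord_gen (e : n ⟶ m) (he : Function.Injective e.1) (f : n ⟶ m) (v : l.V) :
    coord e he (gen l f v) =
      (∑ g : Aut n, if f = (autIso g).hom ≫ e then l.ρ g else 0 : l.V →ₗ[k] l.V) v :=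
  liftL_gen _ _ _ f v

/-- Coordinates at strictly monotone maps are dual to the elements `e ⊗ v`, `e` monotone. -/
theorem coord_gen_self {e : n ⟶ m} (he : StrictMono e.1) (v : l.V) :
    coord e he.injective (gen l e v) = v := by
  classical
  rw [coord_gen, Finset.sum_eq_single 1]
  · rw [if_pos (by rw [Obj.aut_one, Category.id_comp]), map_one]
    rfl
  · intro g _ hg
    refine if_neg fun h => hg ?_
    rw [← Category.id_comp e, ← Obj.aut_one] at h
    exact (Obj.aut_comp_strictMono_inj he he (by simpa [Obj.aut_one] using h)).1.symm
  · simp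

theorem coord_gen_of_ne {e f : n ⟶ m} (he : StrictMono e.1) (hf : Monotone f.1) (h : f ≠ e)
    (v : l.V) : coord e he.injective (gen l f v) = 0 := by
  classical
  rw [coord_gen, Finset.sum_eq_zero]
  · rfl
  · intro g _
    refine if_neg fun H => h ?_
    have hi : Function.Injective f.1 := by
      rw [H]
      exact he.injective.comp (Obj.aut_injective g)
    refine (Obj.aut_comp_strictMono_inj (g := 1) (g' := g) (hf.strictMono_of_injective hi) he ?_).2
    rw [Obj.aut_one, Category.id_comp, H]

/-- An element of `Δ_{n,λ}(m)` is determined by its coordinates at strictly monotone maps. -/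
theorem eq_sum_gen_coord [Fintype {e : n ⟶ m // StrictMono e.1}] (x : (DeltaIrr l).obj m) :
    x = ∑ e : {e : n ⟶ m // StrictMono e.1}, gen l e.1 (coord e.1 e.2.injective x) := by
  have key : (LinearMap.id : (DeltaIrr l).obj m →ₗ[k] (DeltaIrr l).obj m) =
      ∑ e : {e : n ⟶ m // StrictMono e.1}, gen l e.1 ∘ₗ coord e.1 e.2.injective := by
    refine lhom_ext fun f v => ?_
    rw [LinearMap.sum_apply]
    obtain ⟨g, e, he, rfl⟩ := Obj.exists_aut_comp_monotone f
    rw [gen_aut_comp]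
    by_cases hi : Function.Injective e.1
    · have he' := he.strictMono_of_injective hi
      rw [Finset.sum_eq_single ⟨e, he'⟩]
      · rw [LinearMap.comp_apply, coord_gen_self he']
        rfl
      · rintro ⟨e', h'⟩ _ hne
        rw [LinearMap.comp_apply, coord_gen_of_ne h' he fun h => hne (Subtype.ext h.symm), map_zero]
      · simp
    · rw [gen_eq_zero e hi, map_zero]
      simp
  have := congrArg (fun L => L x) key
  simpa only [LinearMap.sum_apply, LinearMap.comp_apply, LinearMap.id_apply] using this

theorem ext_coord {x y : (DeltaIrr l).obj m}
    (h : ∀ (e : n ⟶ m) (he : StrictMono e.1), coord e he.injective x = coord e he.injective y) :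
    x = y := by
  have := Fintype.ofFinite {e : n ⟶ m // StrictMono e.1}
  rw [eq_sum_gen_coord x, eq_sum_gen_coord y]
  exact Finset.sum_congr rfl fun e _ => by rw [h e.1 e.2]

end DeltaIrr

end StandardModules

/-! ### Faces and degeneracies -/

namespace Obj

variable {t : CameronType} {n m p q : Obj t}

theorem eq_of_card_eq (h : (n.card : ℕ) = m.card) : n = m := by
  obtain ⟨n⟩ := n
  obtain ⟨m⟩ := m
  exact congrArg Obj.mk (PNat.eq h)

/-- The monotone surjection `[p+1] → [p]` identifying `j` and `j+1`. -/
def merge (hp : (p.card : ℕ) + 1 = m.card) (j : ℕ) (hj : j + 1 < m.card) : m ⟶ p :=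
  ofMono (fun i => ⟨if (i : ℕ) ≤ j then i else i - 1, by have := i.isLt; split_ifs <;> omega⟩)
    fun a b h => by
      have h : (a : ℕ) ≤ b := h
      refine Fin.mk_le_mk.2 ?_
      split_ifs <;> omega

/-- The monotone injection `[n] → [n+1]` omitting `i`. -/
def face (hn : (n.card : ℕ) + 1 = m.card) (i : ℕ) : n ⟶ m :=
  ofMono (fun a => ⟨if (a : ℕ) < i then a else a + 1, by have := a.isLt; split_ifs <;> omega⟩)
    fun a b h => by
      have h : (a : ℕ) ≤ b := h
      refine Fin.mk_le_mk.2 ?_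
      split_ifs <;> omega

theorem merge_val (hp : (p.card : ℕ) + 1 = m.card) (j : ℕ) (hj : j + 1 < m.card)
    (i : Fin m.card) :
    ((merge hp j hj).1 i : ℕ) = if (i : ℕ) ≤ j then (i : ℕ) else i - 1 := rfl

theorem face_val (hn : (n.card : ℕ) + 1 = m.card) (i : ℕ) (a : Fin n.card) :
    ((face hn i).1 a : ℕ) = if (a : ℕ) < i then (a : ℕ) else a + 1 := rfl

theorem merge_monotone (hp : (p.card : ℕ) + 1 = m.card) (j : ℕ) (hj : j + 1 < m.card) :
    Monotone (merge hp j hj).1 := fun a b h => by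
  have h : (a : ℕ) ≤ b := h
  change ((merge hp j hj).1 a : ℕ) ≤ (merge hp j hj).1 b
  rw [merge_val, merge_val]
  split_ifs <;> omega

theorem face_strictMono (hn : (n.card : ℕ) + 1 = m.card) (i : ℕ) :
    StrictMono (face hn i).1 := fun a b h => by
  have h : (a : ℕ) < b := h
  change ((face hn i).1 a : ℕ) < (face hn i).1 b
  rw [face_val, face_val]
  split_ifs <;> omega

theorem hom_ext_val {f g : n ⟶ m} (h : ∀ a, (f.1 a : ℕ) = g.1 a) : f = g :=
  hom_ext (funext fun a => Fin.ext (h a))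

theorem exists_card_add_one_eq (h : 1 < (m.card : ℕ)) :
    ∃ p : Obj t, (p.card : ℕ) + 1 = m.card :=
  ⟨⟨(⟨m.card - 1, by omega⟩ : ℕ+)⟩, by change (m.card : ℕ) - 1 + 1 = m.card; omega⟩

/-- A non-injective morphism identifies, up to an automorphism of its source, two consecutive
points. -/
theorem exists_factor_merge (f : m ⟶ q) (hf : ¬ Function.Injective f.1) :
    ∃ (p : Obj t) (hp : (p.card : ℕ) + 1 = m.card) (j : ℕ) (hj : j + 1 < m.card) (g : Aut m)
      (h : p ⟶ q), f = (autIso g).hom ≫ merge hp j hj ≫ h := by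
  obtain ⟨g, e, he, rfl⟩ := exists_aut_comp_monotone f
  have hni : ¬ Function.Injective e.1 := fun h => hf (h.comp (aut_injective g))
  obtain ⟨a, b, hab, heq⟩ : ∃ a b, a < b ∧ e.1 a = e.1 b := by
    simp only [Function.Injective] at hni
    push Not at hni
    obtain ⟨a, b, h, hne⟩ := hni
    rcases lt_or_gt_of_ne hne with h' | h'
    · exact ⟨a, b, h', h⟩
    · exact ⟨b, a, h', h.symm⟩
  have hab' : (a : ℕ) < b := hab
  have hb := b.isLt
  obtain ⟨p, hp⟩ := exists_card_add_one_eq (m := m) (by omega)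
  refine ⟨p, hp, a, by omega, g, face hp a ≫ e, ?_⟩
  congr 1
  refine hom_ext (funext fun i => ?_)
  have key : e.1 a = e.1 ⟨a + 1, by omega⟩ :=
    le_antisymm (he (Fin.mk_le_mk.2 (Nat.le_succ _))) (heq ▸ he (Fin.mk_le_mk.2 hab'))
  change e.1 i = e.1 ((face hp a).1 ((merge hp a _).1 i))
  by_cases hi : i = a
  · subst hi
    rw [key]
    refine congrArg e.1 (Fin.ext ?_)
    rw [face_val, merge_val, if_pos le_rfl, if_neg (lt_irrefl _)]
  · have hi : (i : ℕ) ≠ a := fun h => hi (Fin.ext h)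
    refine congrArg e.1 (Fin.ext ?_)
    rw [face_val, merge_val]
    split_ifs <;> omega

theorem face_comp_merge (hn : (n.card : ℕ) + 1 = m.card) (i j : ℕ) (hj : j + 1 < m.card)
    (h : i = j ∨ i = j + 1) : face hn i ≫ merge hn j hj = 𝟙 n := by
  refine hom_ext_val fun a => ?_
  change ((merge hn j hj).1 ((face hn i).1 a) : ℕ) = a
  rw [merge_val, face_val]
  split_ifs <;> omega

theorem face_comp_merge_not_injective (hn : (n.card : ℕ) + 1 = m.card) (i j : ℕ)
    (hj : j + 1 < m.card) (hi : i < m.card) (h : ¬ (i = j ∨ i = j + 1)) :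
    ¬ Function.Injective (face hn i ≫ merge hn j hj).1 := by
  intro H
  have key : ∀ a : ℕ, ∀ ha : a + 1 < n.card, (a = j ∧ j + 1 < i) ∨ (a + 1 = j ∧ i < j) → False := by
    intro a ha hc
    have := @H ⟨a, by omega⟩ ⟨a + 1, ha⟩ (by
      apply Fin.ext
      change ((merge hn j hj).1 ((face hn i).1 _) : ℕ) = (merge hn j hj).1 ((face hn i).1 _)
      rw [merge_val, face_val, merge_val, face_val]
      dsimp only
      split_ifs <;> omega)
    have := Fin.mk.inj_iff.1 this
    omega
  rcases Nat.lt_or_ge i j with h' | h'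
  · exact key (j - 1) (by omega) (Or.inr ⟨by omega, h'⟩)
  · exact key j (by omega) (Or.inl ⟨rfl, by omega⟩)

theorem exists_not_mem_range (e : n ⟶ m) (h : (n.card : ℕ) < m.card) :
    ∃ a : Fin m.card, a ∉ Set.range e.1 := by
  by_contra! H
  have := Fintype.card_le_of_surjective e.1 H
  simp only [Fintype.card_fin] at this
  omega

theorem exists_pair_not_mem_range (e : n ⟶ m) (h : (n.card : ℕ) + 2 ≤ m.card) :
    ∃ a b : Fin m.card, a < b ∧ a ∉ Set.range e.1 ∧ b ∉ Set.range e.1 := by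
  classical
  have h1 : 1 < (Finset.univ.image e.1)ᶜ.card := by
    rw [Finset.card_compl, Fintype.card_fin]
    have : (Finset.univ.image e.1).card ≤ n.card := by
      simpa using Finset.card_image_le (s := Finset.univ) (f := e.1)
    omega
  obtain ⟨a, ha, b, hb, hab⟩ := Finset.one_lt_card.1 h1
  simp only [Finset.mem_compl, Finset.mem_image, Finset.mem_univ, true_and] at ha hb
  rcases lt_or_gt_of_ne hab with h' | h'
  · exact ⟨a, b, h', ha, hb⟩
  · exact ⟨b, a, h', hb, ha⟩

theorem not_mem_range_face (hn : (n.card : ℕ) + 1 = m.card) (a : Fin m.card) :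
    a ∉ Set.range (face hn a).1 := by
  rintro ⟨b, hb⟩
  have := congrArg Fin.val hb
  rw [face_val] at this
  split_ifs at this <;> omega

theorem eq_face (hn : (n.card : ℕ) + 1 = m.card) {e : n ⟶ m} (he : StrictMono e.1) {a : Fin m.card}
    (ha : a ∉ Set.range e.1) : e = face hn a := by
  have key : ∀ {f : n ⟶ m}, Function.Injective f.1 → a ∉ Set.range f.1 → Set.range f.1 = {a}ᶜ := by
    intro f hf haf
    refine Set.eq_of_subset_of_ncard_le (fun x hx hxa => haf (hxa ▸ hx)) ?_
    rw [Set.ncard_compl, Set.ncard_singleton, Set.ncard_range_of_injective hf]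
    simp only [Nat.card_eq_fintype_card, Fintype.card_fin]
    omega
  refine hom_ext ((he.range_inj (face_strictMono hn a)).1 ?_)
  rw [key he.injective ha, key (face_strictMono hn a).injective (not_mem_range_face hn a)]

theorem face_injective (hn : (n.card : ℕ) + 1 = m.card) {i j : ℕ} (hi : i < m.card)
    (hj : j < m.card) (h : face hn i = face hn j) : i = j := by
  by_contra hij
  rcases Nat.lt_or_gt_of_ne hij with h' | h'
  · have := congrArg (fun f : n ⟶ m => (f.1 ⟨i, by omega⟩ : ℕ)) h
    simp only [face_val] at this
    split_ifs at this <;> omega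
  · have := congrArg (fun f : n ⟶ m => (f.1 ⟨j, by omega⟩ : ℕ)) h
    simp only [face_val] at this
    split_ifs at this <;> omega

end Obj

/-! ### Elements killed by all degeneracies -/

namespace DeltaIrr

open Obj

variable {k : Type u} [Field k] {t : CameronType} {n m p : Obj t} {l : Rep.{u} k (Aut n)}

open Classical in
theorem coord_map [Fintype {e : n ⟶ m // StrictMono e.1}] (s : m ⟶ p) (hs : Monotone s.1)
    {e' : n ⟶ p} (he' : StrictMono e'.1) (x : (DeltaIrr l).obj m) :
    coord e' he'.injective (((DeltaIrr l).map s).hom x) =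
      ∑ e : {e : n ⟶ m // StrictMono e.1},
        if e.1 ≫ s = e' then coord e.1 e.2.injective x else 0 := by
  conv_lhs => rw [eq_sum_gen_coord x, map_sum, map_sum]
  refine Finset.sum_congr rfl fun e _ => ?_
  rw [map_gen]
  split_ifs with h
  · subst h
    exact coord_gen_self he' _
  · exact coord_gen_of_ne he' (hs.comp e.2.monotone) h _

section Killed

variable (hp : (p.card : ℕ) + 1 = m.card) {x : (DeltaIrr l).obj m} {j : ℕ} {hj : j + 1 < m.card}

/-- If `x` is killed by the degeneracy identifying `j` and `j+1`, then its coordinates at maps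
avoiding both `j` and `j+1` vanish. -/
theorem coord_eq_zero_of_merge (hx : ((DeltaIrr l).map (merge hp j hj)).hom x = 0) {e : n ⟶ m}
    (he : StrictMono e.1) (h1 : ∀ a, (e.1 a : ℕ) ≠ j) (h2 : ∀ a, (e.1 a : ℕ) ≠ j + 1) :
    coord e he.injective x = 0 := by
  classical
  have := Fintype.ofFinite {e : n ⟶ m // StrictMono e.1}
  have he' : StrictMono (e ≫ merge hp j hj).1 := fun a b hab => by
    have hab : (e.1 a : ℕ) < e.1 b := he hab
    have := h1 a
    have := h2 a
    have := h1 b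
    have := h2 b
    change ((merge hp j hj).1 (e.1 a) : ℕ) < (merge hp j hj).1 (e.1 b)
    rw [merge_val, merge_val]
    split_ifs <;> omega
  have key := coord_map (merge hp j hj) (merge_monotone hp j hj) he' x
  rw [hx, map_zero, Finset.sum_eq_single ⟨e, he⟩] at key
  · rw [if_pos rfl] at key
    exact key.symm
  · rintro ⟨f, hf⟩ _ hne
    refine if_neg fun h => hne (Subtype.ext (hom_ext_val fun a => ?_))
    have h := congrArg (fun f : n ⟶ p => (f.1 a : ℕ)) h
    change ((merge hp j hj).1 (f.1 a) : ℕ) = (merge hp j hj).1 (e.1 a) at h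
    rw [merge_val, merge_val] at h
    have := h1 a
    have := h2 a
    change (f.1 a : ℕ) = e.1 a
    split_ifs at h <;> omega
  · simp

/-- If `x` is killed by the degeneracy identifying `j` and `j+1`, then its coordinates at two maps
that differ only by exchanging `j` for `j+1` are opposite. -/
theorem coord_add_coord_of_merge (hx : ((DeltaIrr l).map (merge hp j hj)).hom x = 0)
    {e f : n ⟶ m} (he : StrictMono e.1) (hf : StrictMono f.1) {i : Fin n.card}
    (hei : (e.1 i : ℕ) = j) (hfi : (f.1 i : ℕ) = j + 1) (h : ∀ a, a ≠ i → e.1 a = f.1 a) :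
    coord e he.injective x + coord f hf.injective x = 0 := by
  classical
  have := Fintype.ofFinite {e : n ⟶ m // StrictMono e.1}
  -- away from `i` the common values of `e` and `f` are neither `j` nor `j + 1`
  have h1 : ∀ a, a ≠ i → (e.1 a : ℕ) ≠ j ∧ (e.1 a : ℕ) ≠ j + 1 := by
    intro a ha
    refine ⟨fun H => ha (he.injective (Fin.ext (H.trans hei.symm))), fun H => ?_⟩
    rw [h a ha] at H
    exact ha (hf.injective (Fin.ext (H.trans hfi.symm)))
  have hef : e ≫ merge hp j hj = f ≫ merge hp j hj := by
    refine hom_ext_val fun a => ?_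
    change ((merge hp j hj).1 (e.1 a) : ℕ) = (merge hp j hj).1 (f.1 a)
    by_cases ha : a = i
    · subst ha
      rw [merge_val, merge_val]
      split_ifs <;> omega
    · rw [h a ha]
  have he' : StrictMono (e ≫ merge hp j hj).1 := fun a b hab => by
    have hab' : (e.1 a : ℕ) < e.1 b := he hab
    have hfab : (f.1 a : ℕ) < f.1 b := hf hab
    change ((merge hp j hj).1 (e.1 a) : ℕ) < (merge hp j hj).1 (e.1 b)
    rw [merge_val, merge_val]
    by_cases ha : a = i
    · subst ha
      have := h1 b hab.ne'
      split_ifs <;> omega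
    · have := h1 a ha
      split_ifs <;> omega
  have key := coord_map (merge hp j hj) (merge_monotone hp j hj) he' x
  have hne : (⟨e, he⟩ : {e : n ⟶ m // StrictMono e.1}) ≠ ⟨f, hf⟩ := fun H => by
    have := congrArg (fun f : {e : n ⟶ m // StrictMono e.1} => (f.1.1 i : ℕ)) H
    dsimp only at this
    omega
  rw [hx, map_zero, ← Finset.sum_subset (Finset.subset_univ {⟨e, he⟩, ⟨f, hf⟩}),
    Finset.sum_pair hne, if_pos rfl, if_pos hef.symm] at key
  · exact key.symm
  · rintro ⟨g, hg⟩ _ hgm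
    refine if_neg fun H => hgm ?_
    have H' : ∀ a, (if (g.1 a : ℕ) ≤ j then (g.1 a : ℕ) else g.1 a - 1) =
        if (e.1 a : ℕ) ≤ j then (e.1 a : ℕ) else e.1 a - 1 := fun a =>
      congrArg (fun f : n ⟶ p => (f.1 a : ℕ)) H
    have hga : ∀ a, a ≠ i → (g.1 a : ℕ) = e.1 a := fun a ha => by
      have := H' a
      have := h1 a ha
      split_ifs at * <;> omega
    have hgi : (g.1 i : ℕ) = e.1 i ∨ (g.1 i : ℕ) = f.1 i := by
      have := H' i
      split_ifs at * <;> omega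
    rw [Finset.mem_insert, Finset.mem_singleton]
    rcases hgi with hgi | hgi
    · refine Or.inl (Subtype.ext (hom_ext_val fun a => ?_))
      by_cases ha : a = i
      · rw [ha]; exact hgi
      · exact hga a ha
    · refine Or.inr (Subtype.ext (hom_ext_val fun a => ?_))
      by_cases ha : a = i
      · rw [ha]; exact hgi
      · exact (hga a ha).trans (congrArg Fin.val (h a ha))

/-- For `m ≥ n + 2`, no nonzero element of `Δ_{n,λ}(m)` is killed by all degeneracies: a map
`e : [n] → [m]` misses two points, which can be moved next to each other at the cost of a sign. -/
theorem eq_zero_of_merge (hnm : (n.card : ℕ) + 2 ≤ m.card)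
    (hx : ∀ j hj, ((DeltaIrr l).map (merge hp j hj)).hom x = 0) : x = 0 := by
  have key : ∀ (d a : ℕ) (e : n ⟶ m) (he : StrictMono e.1), (∀ i, (e.1 i : ℕ) ≠ a) →
      (∀ i, (e.1 i : ℕ) ≠ a + 1 + d) → a + 1 + d < m.card → coord e he.injective x = 0 := by
    intro d
    induction d with
    | zero => exact fun a e he h1 h2 h3 => coord_eq_zero_of_merge hp (hx a h3) he h1 h2
    | succ d ih =>
      intro a e he h1 h2 h3
      by_cases h : ∀ i, (e.1 i : ℕ) ≠ a + 1
      · exact coord_eq_zero_of_merge hp (hx a (by omega)) he h1 h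
      · push Not at h
        obtain ⟨i, hi⟩ := h
        let f0 : Fin n.card → Fin m.card := fun b => if b = i then ⟨a, by omega⟩ else e.1 b
        have hf0i : (f0 i : ℕ) = a := by simp [f0]
        have hf0 : ∀ b, b ≠ i → f0 b = e.1 b := fun b hb => if_neg hb
        have hf : StrictMono f0 := fun b c hbc => by
          have hbc' : (e.1 b : ℕ) < e.1 c := he hbc
          change (f0 b : ℕ) < f0 c
          by_cases hb : b = i
          · subst hb
            rw [hf0 c hbc.ne', hf0i]
            omega
          · by_cases hc : c = i
            · subst hc
              rw [hf0 b hb, hf0i]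
              have := h1 b
              omega
            · rw [hf0 b hb, hf0 c hc]
              exact hbc'
        have hadd := coord_add_coord_of_merge (e := ofMono f0 hf.monotone) hp (hx a (by omega))
          hf he hf0i hi hf0
        have h0 := ih (a + 1) (ofMono f0 hf.monotone) hf
          (fun b => by
            change (f0 b : ℕ) ≠ a + 1
            by_cases hb : b = i
            · rw [hb, hf0i]; omega
            · rw [hf0 b hb]
              exact fun H => hb (he.injective (Fin.ext (H.trans hi.symm))))
          (fun b => by
            change (f0 b : ℕ) ≠ a + 1 + 1 + d
            by_cases hb : b = i
            · rw [hb, hf0i]; omega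
            · rw [hf0 b hb]
              have := h2 b
              omega) (by omega)
        rwa [h0, zero_add] at hadd
  refine ext_coord fun e he => ?_
  rw [map_zero]
  obtain ⟨a, b, hab, ha, hb⟩ := exists_pair_not_mem_range e hnm
  have hab : (a : ℕ) < b := hab
  refine key (b - a - 1) a e he (fun i h => ha ⟨i, Fin.ext h⟩)
    (fun i h => hb ⟨i, Fin.ext (by omega)⟩) (by omega)

end Killed

section AltSum

variable (hn : (n.card : ℕ) + 1 = m.card)

variable (l) in
/-- The alternating sum of faces `∑ (-1)^i d_i ⊗ v` in `Δ_{n,λ}(n+1)`. -/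
def altSum : l.V →ₗ[k] (DeltaIrr l).obj m :=
  ∑ i ∈ Finset.range m.card, (-1 : k) ^ i • gen l (face hn i)

theorem altSum_apply (v : l.V) :
    altSum l hn v = ∑ i ∈ Finset.range m.card, (-1 : k) ^ i • gen l (face hn i) v := by
  simp [altSum]

theorem coord_altSum {i : ℕ} (hi : i < m.card) (v : l.V) :
    coord (face hn i) (face_strictMono hn i).injective (altSum l hn v) = (-1 : k) ^ i • v := by
  rw [altSum_apply, map_sum, Finset.sum_eq_single i]
  · rw [map_smul, coord_gen_self (face_strictMono hn i)]
  · intro j hj hji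
    rw [map_smul, coord_gen_of_ne (face_strictMono hn i) (face_strictMono hn j).monotone, smul_zero]
    exact fun h => hji (face_injective hn (Finset.mem_range.1 hj) hi h)
  · exact fun h => absurd (Finset.mem_range.2 hi) h

theorem altSum_injective : Function.Injective (altSum l hn) := by
  refine (injective_iff_map_eq_zero _).2 fun v hv => ?_
  have := coord_altSum hn (show 0 < (m.card : ℕ) by omega) v
  rw [hv, map_zero, pow_zero, one_smul] at this
  exact this.symm

theorem map_merge_altSum {j : ℕ} (hj : j + 1 < m.card) (v : l.V) :
    ((DeltaIrr l).map (merge hn j hj)).hom (altSum l hn v) = 0 := by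
  rw [altSum_apply, map_sum, ← Finset.sum_subset (s₁ := {j, j + 1}), Finset.sum_pair (by omega)]
  · simp only [map_smul, map_gen]
    rw [face_comp_merge hn j j hj (Or.inl rfl), face_comp_merge hn (j + 1) j hj (Or.inr rfl),
      pow_succ, mul_neg_one, neg_smul, add_neg_cancel]
  · intro i hi
    simp only [Finset.mem_insert, Finset.mem_singleton] at hi
    exact Finset.mem_range.2 (by omega)
  · intro i hi hij
    simp only [Finset.mem_insert, Finset.mem_singleton] at hij
    rw [map_smul, map_gen, gen_eq_zero _
      (face_comp_merge_not_injective hn i j hj (Finset.mem_range.1 hi) hij), smul_zero]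

/-- The elements of `Δ_{n,λ}(n+1)` killed by all degeneracies are the alternating sums. -/
theorem eq_altSum_of_merge {x : (DeltaIrr l).obj m}
    (hx : ∀ j hj, ((DeltaIrr l).map (merge hn j hj)).hom x = 0) : ∃ v, x = altSum l hn v := by
  refine ⟨coord (face hn 0) (face_strictMono hn 0).injective x, ?_⟩
  have key : ∀ i : ℕ, i < m.card → coord (face hn i) (face_strictMono hn i).injective x =
      (-1 : k) ^ i • coord (face hn 0) (face_strictMono hn 0).injective x := by
    intro i
    induction i with
    | zero => simp
    | succ i ih =>
      intro hi
      have := coord_add_coord_of_merge hn (hx i hi) (face_strictMono hn (i + 1))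
        (face_strictMono hn i) (i := ⟨i, by omega⟩) (by simp [face_val]) (by simp [face_val])
        (fun a ha => by
          have ha : (a : ℕ) ≠ i := fun h => ha (Fin.ext h)
          apply Fin.ext
          rw [face_val, face_val]
          split_ifs <;> omega)
      rw [eq_neg_of_add_eq_zero_left this, ih (by omega), pow_succ, mul_neg_one, neg_smul]
  refine ext_coord fun e he => ?_
  obtain ⟨a, ha⟩ := exists_not_mem_range e (by omega)
  obtain rfl := eq_face hn he ha
  rw [coord_altSum hn a.isLt, key a a.isLt]

end AltSum

end DeltaIrr

/-! ### Irreducible representations -/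

section Representations

variable {k : Type u} [Field k] {G : Type} [Group G]

theorem Rep.exists_ne_zero {l : Rep.{u} k G} (hl : l.ρ.IsIrreducible) : ∃ v : l.V, v ≠ 0 := by
  by_contra! H
  refine (bot_ne_top : (⊥ : Subrepresentation l.ρ) ≠ ⊤) (SetLike.ext fun v => ?_)
  rw [H v]
  exact ⟨fun _ => Submodule.mem_top (R := k), fun _ => zero_mem (⊥ : Submodule k l.V)⟩

theorem Rep.eq_bot_or_eq_top {l : Rep.{u} k G} (hl : l.ρ.IsIrreducible) (N : Submodule k l.V)
    (hN : ∀ g, ∀ v ∈ N, l.ρ g v ∈ N) : N = ⊥ ∨ N = ⊤ :=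
  (hl.eq_bot_or_eq_top ⟨N, fun g v hv => hN g v hv⟩).imp
    (congrArg Subrepresentation.toSubmodule) (congrArg Subrepresentation.toSubmodule)

/-- An irreducible representation containing a joint eigenvector `u` is spanned by it. -/
theorem Rep.exists_eq_smul {l : Rep.{u} k G} (hl : l.ρ.IsIrreducible) {u : l.V} (hu : u ≠ 0)
    (h : ∀ g, ∃ c : k, l.ρ g u = c • u) (v : l.V) : ∃ c : k, v = c • u := by
  have hN : ∀ g, ∀ v ∈ Submodule.span k {u}, l.ρ g v ∈ Submodule.span k {u} := by
    intro g v hv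
    obtain ⟨a, rfl⟩ := Submodule.mem_span_singleton.1 hv
    obtain ⟨c, hc⟩ := h g
    rw [map_smul, hc]
    exact Submodule.smul_mem _ _ (Submodule.smul_mem _ _ (Submodule.mem_span_singleton_self u))
  rcases Rep.eq_bot_or_eq_top hl _ hN with h' | h'
  · exact absurd (Submodule.span_singleton_eq_bot.1 h') hu
  · have : v ∈ Submodule.span k {u} := by rw [h']; trivial
    obtain ⟨c, hc⟩ := Submodule.mem_span_singleton.1 this
    exact ⟨c, hc.symm⟩

theorem Rep.apply_eq_smul {l : Rep.{u} k G} (hl : l.ρ.IsIrreducible) {u : l.V} (hu : u ≠ 0)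
    (h : ∀ g, ∃ c : k, l.ρ g u = c • u) {g : G} {c : k} (hg : l.ρ g u = c • u) (v : l.V) :
    l.ρ g v = c • v := by
  obtain ⟨a, rfl⟩ := Rep.exists_eq_smul hl hu h v
  rw [map_smul, hg, smul_comm]

/-- Over a field of characteristic zero, a nonzero subrepresentation of a representation of a
finite group contains an irreducible one. -/
theorem Subrepresentation.exists_irreducible [CharZero k] [Finite G] {M : Type u} [AddCommGroup M]
    [Module k M] {ρ : Representation k G M} {W : Subrepresentation ρ} (hW : W ≠ ⊥) :
    ∃ l : Rep.{u} k G, l.ρ.IsIrreducible ∧ ∃ θ : l.V →ₗ[k] M, θ ≠ 0 ∧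
      (∀ g u, θ (l.ρ g u) = ρ g (θ u)) ∧ ∀ u, θ u ∈ W := by
  have : NeZero (Nat.card G : k) := ⟨Nat.cast_ne_zero.2 Nat.card_pos.ne'⟩
  have : IsAtomic (Subrepresentation ρ) :=
    (OrderIso.isAtomic_iff Subrepresentation.subrepresentationSubmoduleOrderIso).2
      (inferInstanceAs (IsAtomic (Submodule (MonoidAlgebra k G) ρ.asModule)))
  obtain ⟨A, hA, hAW⟩ := (IsAtomic.eq_bot_or_exists_atom_le W).resolve_left hW
  have hne : A.toSubmodule ≠ ⊥ := fun h => hA.1 (Subrepresentation.toSubmodule_injective h)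
  obtain ⟨a, ha, ha0⟩ := Submodule.exists_mem_ne_zero_of_ne_bot hne
  refine ⟨Rep.of A.toRepresentation, ?_, A.toSubmodule.subtype, ?_, fun g u => rfl,
    fun u => hAW u.2⟩
  · refine { exists_pair_ne := ⟨⊥, ⊤, fun h => ha0 ?_⟩, eq_bot_or_eq_top := fun T => ?_ }
    · have : (⟨a, ha⟩ : A.toSubmodule) ∈ (⊥ : Subrepresentation A.toRepresentation) := by
        rw [h]; trivial
      exact congrArg Subtype.val ((Submodule.mem_bot k).1 this)
    · let T' : Subrepresentation ρ :=
        ⟨T.toSubmodule.map A.toSubmodule.subtype, fun g => by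
          rintro _ ⟨x, hx, rfl⟩
          exact ⟨A.toRepresentation g x, T.apply_mem_toSubmodule g hx, rfl⟩⟩
      have hT' : T' ≤ A := by
        rintro _ ⟨x, -, rfl⟩
        exact x.2
      rcases hA.le_iff.1 hT' with h | h
      · refine Or.inl (SetLike.ext fun x => ⟨fun hx => ?_, fun hx => ?_⟩)
        · have : x.1 ∈ T' := ⟨x, hx, rfl⟩
          rw [h] at this
          exact (Submodule.mem_bot k).2 (Subtype.ext ((Submodule.mem_bot k).1 this))
        · rw [(Submodule.mem_bot k).1 hx]
          exact zero_mem T.toSubmodule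
      · refine Or.inr (SetLike.ext fun x => ⟨fun _ => trivial, fun _ => ?_⟩)
        have : x.1 ∈ T' := by rw [h]; exact x.2
        obtain ⟨y, hy, hyx⟩ := this
        rw [← Subtype.ext hyx]
        exact hy
  · intro h
    exact ha0 (congrArg (fun L => L (⟨a, ha⟩ : A.toSubmodule)) h)

end Representations

/-! ### Generators of the automorphism groups -/

namespace Obj

variable {t : CameronType} {n m : Obj t}

/-- The exchange of `j` and `j+1`. -/
def swapSucc (N j : ℕ) (hj : j + 1 < N) : Equiv.Perm (Fin N) :=
  Equiv.swap ⟨j, by omega⟩ ⟨j + 1, hj⟩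

theorem swapSucc_val (N j : ℕ) (hj : j + 1 < N) (i : Fin N) :
    (swapSucc N j hj i : ℕ) = if (i : ℕ) = j then j + 1 else if (i : ℕ) = j + 1 then j else i := by
  rw [swapSucc, Equiv.swap_apply_def]
  simp only [Fin.ext_iff]
  split_ifs <;> rfl

/-- The standard generators of `G_N`: exchanges of neighbours, the rotation, the reversal. -/
def IsGen (t : CameronType) {N : ℕ} (s : Fin N → Fin N) : Prop :=
  match t with
  | .FA => ∃ j hj, s = swapSucc N j hj
  | .OA => False
  | .CA => s = rot N 1
  | .BA => s = Fin.rev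
  | .SA => s = rot N 1 ∨ s = Fin.rev

theorem perm_induction {N : ℕ} {P : Equiv.Perm (Fin N) → Prop} (one : P 1)
    (mul : ∀ g h, P g → P h → P (g * h)) (gen : ∀ j hj, P (swapSucc N j hj))
    (g : Equiv.Perm (Fin N)) : P g := by
  cases N with
  | zero => rwa [Subsingleton.elim g 1]
  | succ N =>
    have hg : g ∈ Submonoid.closure (Set.range fun i : Fin N => Equiv.swap i.castSucc i.succ) := by
      rw [Equiv.Perm.mclosure_swap_castSucc_succ]
      trivial
    induction hg using Submonoid.closure_induction with
    | mem x hx =>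
      obtain ⟨i, rfl⟩ := hx
      exact gen i (Nat.succ_lt_succ i.isLt)
    | one => exact one
    | mul x y _ _ hx hy => exact mul x y hx hy

/-- A permutation as an automorphism of a pure set. -/
def permAut (n : Obj .FA) : Equiv.Perm (Fin n.card) →* Aut n where
  toFun s := mkAut s s.symm trivial trivial (by simp) (by simp)
  map_one' := aut_ext rfl
  map_mul' _ _ := aut_ext rfl

theorem permAut_hom (n : Obj .FA) (s : Equiv.Perm (Fin n.card)) :
    (autIso (permAut n s)).hom.1 = s := rfl

theorem exists_permAut_eq {n : Obj .FA} (g : Aut n) : ∃ s, permAut n s = g :=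
  ⟨Equiv.ofBijective _ ⟨aut_injective g, aut_surjective g⟩, aut_ext rfl⟩

/-- The rotation by `r` as an automorphism, when it is one. -/
def rotAut (n : Obj t) (h : ∀ r, IsMor t (rot n.card r)) (r : ℕ) : Aut n :=
  mkAut (rot _ r) (rot _ (n.card - r % n.card)) (h _) (h _) (rot_sub_comp_rot _ _)
    (rot_comp_rot_sub _ _)

theorem rotAut_hom (h : ∀ r, IsMor t (rot n.card r)) (r : ℕ) :
    (autIso (rotAut n h r)).hom.1 = rot n.card r := rfl

/-- The reversal as an automorphism, when it is one. -/
def revAut (n : Obj t) (h : IsMor t (Fin.rev : Fin n.card → Fin n.card)) : Aut n :=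
  mkAut Fin.rev Fin.rev h h (rev_comp_rev _) (rev_comp_rev _)

theorem isMor_rot_CA (N r : ℕ) : IsMor .CA (rot N r) := isCyclicMono_rot N r

theorem isMor_rot_SA (N r : ℕ) : IsMor .SA (rot N r) := Or.inl (isCyclicMono_rot N r)

theorem isMor_rev_BA (N : ℕ) : IsMor .BA (Fin.rev : Fin N → Fin N) :=
  Or.inr fun _ _ h => Fin.rev_le_rev.2 h

theorem isMor_rev_SA (N : ℕ) : IsMor .SA (Fin.rev : Fin N → Fin N) := Or.inr (isCyclicAnti_rev N)

theorem rotAut_induction {P : Aut n → Prop} (h : ∀ r, IsMor t (rot n.card r)) (one : P 1)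
    (mul : ∀ g h, P g → P h → P (g * h)) (gen : ∀ g, (autIso g).hom.1 = rot _ 1 → P g) (r : ℕ) :
    P (rotAut n h r) := by
  induction r with
  | zero =>
    have : rotAut n h 0 = 1 := aut_ext (by rw [rotAut_hom, rot_zero]; rfl)
    rwa [this]
  | succ r ih =>
    have : rotAut n h (r + 1) = rotAut n h r * rotAut n h 1 := aut_ext <| by
      rw [aut_mul, comp_val, rotAut_hom, rotAut_hom, rotAut_hom, rot_comp, Nat.add_comm]
    rw [this]
    exact mul _ _ ih (gen _ rfl)

theorem eq_rot_of_monotone {g : Aut n} {r : ℕ} (hr : Monotone ((autIso g).hom.1 ∘ rot _ r)) :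
    (autIso g).hom.1 = rot _ (n.card - r % n.card) := by
  have hinj : Function.Injective (rot n.card r) :=
    Function.LeftInverse.injective (congrFun (rot_sub_comp_rot n.card r))
  have h1 := eq_id_of_strictMono (hr.strictMono_of_injective ((aut_injective g).comp hinj))
  calc (autIso g).hom.1 = (autIso g).hom.1 ∘ (rot _ r ∘ rot _ (n.card - r % n.card)) := by
        rw [rot_comp_rot_sub]; rfl
    _ = ((autIso g).hom.1 ∘ rot _ r) ∘ rot _ (n.card - r % n.card) := rfl
    _ = _ := by rw [h1]; rfl

/-- The standard generators generate `G_n`. -/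
theorem aut_induction {P : Aut n → Prop} (one : P 1) (mul : ∀ g h, P g → P h → P (g * h))
    (gen : ∀ g, IsGen t (autIso g).hom.1 → P g) (g : Aut n) : P g := by
  cases t with
  | FA =>
    obtain ⟨s, rfl⟩ := exists_permAut_eq g
    refine perm_induction (P := fun s => P (permAut n s)) (by rwa [map_one]) ?_ ?_ s
    · intro a b ha hb
      rw [map_mul]
      exact mul _ _ ha hb
    · exact fun j hj => gen _ ⟨j, hj, rfl⟩
  | OA =>
    have : g = 1 := aut_ext <| eq_id_of_strictMono <|
      ((autIso g).hom.2 : Monotone _).strictMono_of_injective (aut_injective g)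
    rwa [this]
  | CA =>
    obtain ⟨r, hr⟩ : IsCyclicMono _ := (autIso g).hom.2
    rw [show g = rotAut n (isMor_rot_CA _) _ from aut_ext (eq_rot_of_monotone hr)]
    exact rotAut_induction _ one mul gen _
  | BA =>
    rcases (autIso g).hom.2 with h | h
    · have : g = 1 := aut_ext <| eq_id_of_strictMono <|
        h.strictMono_of_injective (aut_injective g)
      rwa [this]
    · refine gen g ?_
      have h1 : Monotone ((autIso g).hom.1 ∘ Fin.rev) := fun i j hij => h (Fin.rev_le_rev.2 hij)
      have h2 := eq_id_of_strictMono <|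
        h1.strictMono_of_injective ((aut_injective g).comp Fin.rev_injective)
      calc (autIso g).hom.1 = ((autIso g).hom.1 ∘ Fin.rev) ∘ Fin.rev := by
            rw [Function.comp_assoc, rev_comp_rev]; rfl
        _ = Fin.rev := by rw [h2]; rfl
  | SA =>
    have hrot : ∀ g : Aut n, IsCyclicMono (autIso g).hom.1 → P g := by
      rintro g ⟨r, hr⟩
      rw [show g = rotAut n (isMor_rot_SA _) _ from aut_ext (eq_rot_of_monotone hr)]
      exact rotAut_induction _ one mul (fun g hg => gen g (Or.inl hg)) _
    rcases (autIso g).hom.2 with h | h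
    · exact hrot g h
    · let τ := revAut n (isMor_rev_SA _)
      have hτ : τ * τ = 1 := aut_ext (by rw [aut_mul]; exact rev_comp_rev _)
      have : g = τ * (τ * g) := by rw [← mul_assoc, hτ, one_mul]
      rw [this]
      refine mul _ _ (gen _ (Or.inr rfl)) (hrot _ ?_)
      rw [aut_mul]
      exact isCyclicAnti_iff.1 h

/-! ### Generators and faces -/

variable (hn : (n.card : ℕ) + 1 = m.card)

theorem face_comp_rot_last {γ : Aut m} (hγ : (autIso γ).hom.1 = rot _ 1) :
    face hn n.card ≫ (autIso γ).hom = (autIso (1 : Aut n)).hom ≫ face hn 0 := by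
  refine hom_ext_val fun a => ?_
  change ((autIso γ).hom.1 ((face hn _).1 a) : ℕ) = (face hn 0).1 a
  have := a.isLt
  rw [hγ, rot_val _ (by omega), face_val, face_val]
  split_ifs <;> omega

theorem face_comp_rot {γ : Aut m} (hγ : (autIso γ).hom.1 = rot _ 1) {h : Aut n}
    (hh : (autIso h).hom.1 = rot _ 1) {i : ℕ} (hi : i < n.card) :
    face hn i ≫ (autIso γ).hom = (autIso h).hom ≫ face hn (i + 1) := by
  refine hom_ext_val fun a => ?_
  change ((autIso γ).hom.1 ((face hn _).1 a) : ℕ) = (face hn _).1 ((autIso h).hom.1 a)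
  have := a.isLt
  rw [hγ, hh, rot_val _ (by omega), face_val, face_val, rot_val _ (by omega)]
  split_ifs <;> omega

theorem face_comp_rev {γ : Aut m} (hγ : (autIso γ).hom.1 = Fin.rev) {h : Aut n}
    (hh : (autIso h).hom.1 = Fin.rev) {i : ℕ} (hi : i < m.card) :
    face hn i ≫ (autIso γ).hom = (autIso h).hom ≫ face hn (n.card - i) := by
  refine hom_ext_val fun a => ?_
  change ((autIso γ).hom.1 ((face hn _).1 a) : ℕ) = (face hn _).1 ((autIso h).hom.1 a)
  have := a.isLt
  rw [hγ, hh, Fin.val_rev, face_val, face_val, Fin.val_rev]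
  split_ifs <;> omega

theorem face_comp_swap_self {γ : Aut m} {j : ℕ} {hj : j + 1 < m.card}
    (hγ : (autIso γ).hom.1 = swapSucc _ j hj) :
    face hn j ≫ (autIso γ).hom = (autIso (1 : Aut n)).hom ≫ face hn (j + 1) := by
  refine hom_ext_val fun a => ?_
  change ((autIso γ).hom.1 ((face hn _).1 a) : ℕ) = (face hn _).1 a
  rw [hγ, swapSucc_val, face_val, face_val]
  split_ifs <;> omega

theorem face_comp_swap_succ {γ : Aut m} {j : ℕ} {hj : j + 1 < m.card}
    (hγ : (autIso γ).hom.1 = swapSucc _ j hj) :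
    face hn (j + 1) ≫ (autIso γ).hom = (autIso (1 : Aut n)).hom ≫ face hn j := by
  refine hom_ext_val fun a => ?_
  change ((autIso γ).hom.1 ((face hn _).1 a) : ℕ) = (face hn _).1 a
  rw [hγ, swapSucc_val, face_val, face_val]
  split_ifs <;> omega

theorem face_comp_swap_of_gt {γ : Aut m} {j : ℕ} {hj : j + 1 < m.card}
    (hγ : (autIso γ).hom.1 = swapSucc _ j hj) {h : Aut n} {hj' : j + 1 < n.card}
    (hh : (autIso h).hom.1 = swapSucc _ j hj') {i : ℕ} (hi : j + 1 < i) :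
    face hn i ≫ (autIso γ).hom = (autIso h).hom ≫ face hn i := by
  refine hom_ext_val fun a => ?_
  change ((autIso γ).hom.1 ((face hn _).1 a) : ℕ) = (face hn _).1 ((autIso h).hom.1 a)
  rw [hγ, hh, swapSucc_val, face_val, face_val, swapSucc_val]
  split_ifs <;> omega

theorem face_comp_swap_of_lt {γ : Aut m} {j : ℕ} {hj : j + 1 + 1 < m.card}
    (hγ : (autIso γ).hom.1 = swapSucc _ (j + 1) hj) {h : Aut n} {hj' : j + 1 < n.card}
    (hh : (autIso h).hom.1 = swapSucc _ j hj') {i : ℕ} (hi : i ≤ j) :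
    face hn i ≫ (autIso γ).hom = (autIso h).hom ≫ face hn i := by
  refine hom_ext_val fun a => ?_
  change ((autIso γ).hom.1 ((face hn _).1 a) : ℕ) = (face hn _).1 ((autIso h).hom.1 a)
  rw [hγ, hh, swapSucc_val, face_val, face_val, swapSucc_val]
  split_ifs <;> omega

end Obj

/-! ### Elements killed by all non-injective morphisms -/

section Killed

open Obj

variable {k : Type u} [Field k] {t : CameronType} {n m p : Obj t}

/-- The value `V([n])` as a representation of `G_n`. -/
def autRep (V : CatMod (Obj t) k) (n : Obj t) : Rep.{u} k (Aut n) :=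
  Rep.of (X := V.obj n)
    { toFun := fun g => (V.map (autIso g).hom).hom
      map_one' := LinearMap.ext fun x => CatMod.map_id_apply V x
      map_mul' := fun g h => LinearMap.ext fun x =>
        CatMod.map_comp_apply V (autIso h).hom (autIso g).hom x }

/-- The elements of `V([n])` killed by all non-injective morphisms. -/
def killedSubmodule (V : CatMod (Obj t) k) (n : Obj t) : Submodule k (V.obj n) :=
  ⨅ (m : Obj t) (f : n ⟶ m) (_ : ¬ Function.Injective f.1), LinearMap.ker (V.map f).hom

theorem mem_killedSubmodule {V : CatMod (Obj t) k} {x : V.obj n} :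
    x ∈ killedSubmodule V n ↔
      ∀ (m : Obj t) (f : n ⟶ m), ¬ Function.Injective f.1 → (V.map f).hom x = 0 := by
  simp only [killedSubmodule, Submodule.mem_iInf, LinearMap.mem_ker]

/-- The elements of `V([n])` killed by all non-injective morphisms, as a subrepresentation. -/
def killed (V : CatMod (Obj t) k) (n : Obj t) : Subrepresentation (autRep V n).ρ where
  toSubmodule := killedSubmodule V n
  apply_mem_toSubmodule g _ hx := mem_killedSubmodule.2 fun m f hf =>
    (CatMod.map_comp_apply V (autIso g).hom f _).symm.trans
      (mem_killedSubmodule.1 hx m _ fun h => hf (aut_comp_injective h))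

theorem mem_killed {V : CatMod (Obj t) k} {x : V.obj n} :
    x ∈ killed V n ↔
      ∀ (m : Obj t) (f : n ⟶ m), ¬ Function.Injective f.1 → (V.map f).hom x = 0 :=
  mem_killedSubmodule

/-- An element is killed by all non-injective morphisms as soon as all degeneracies kill its
translates under automorphisms. -/
theorem mem_killed_of_merge {V : CatMod (Obj t) k} {x : V.obj m}
    (H : ∀ (p : Obj t) (hp : (p.card : ℕ) + 1 = m.card) (j : ℕ) (hj : j + 1 < m.card) (g : Aut m),
      (V.map (merge hp j hj)).hom ((V.map (autIso g).hom).hom x) = 0) : x ∈ killed V m := by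
  refine mem_killed.2 fun q f hf => ?_
  obtain ⟨p, hp, j, hj, g, h, rfl⟩ := exists_factor_merge f hf
  rw [CatMod.map_comp_apply, CatMod.map_comp_apply, H, map_zero]

theorem map_merge_of_mem_killed {V : CatMod (Obj t) k} {x : V.obj m} (hx : x ∈ killed V m)
    (hp : (p.card : ℕ) + 1 = m.card) (j : ℕ) (hj : j + 1 < m.card) :
    (V.map (merge hp j hj)).hom x = 0 :=
  mem_killed.1 hx _ _ fun h => by
    have := card_le_of_injective _ h
    omega

theorem exists_delta_hom_ne_zero_iff {V : CatMod (Obj t) k} :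
    (∃ φ : Delta k n ⟶ V, φ ≠ 0) ↔ killed V n ≠ ⊥ := by
  constructor
  · rintro ⟨φ, hφ⟩ h
    refine hφ (Delta.hom_ext ?_)
    have : (φ.app n).hom (Delta.cls (𝟙 n)) ∈ killed V n := mem_killed.2 fun m f hf => by
      rw [← CatMod.naturality_apply, Delta.map_cls, Category.id_comp, Delta.cls_eq_zero f hf,
        map_zero]
    rw [h] at this
    exact (Submodule.mem_bot k).1 this
  · intro h
    obtain ⟨x, hx, h0⟩ : ∃ x ∈ (killed V n).toSubmodule, x ≠ 0 :=
      Submodule.exists_mem_ne_zero_of_ne_bot fun H =>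
        h (Subrepresentation.toSubmodule_injective H)
    refine ⟨Delta.desc x (mem_killed.1 hx), fun h => h0 ?_⟩
    rw [← CatMod.map_id_apply V x, ← Delta.desc_cls x (mem_killed.1 hx), h]
    rfl

namespace DeltaIrr

variable {l : Rep.{u} k (Aut n)}

theorem apply_gen_mem_killed {V : CatMod (Obj t) k} (φ : DeltaIrr l ⟶ V) (u : l.V) :
    (φ.app n).hom (gen l (𝟙 n) u) ∈ killed V n :=
  mem_killed.2 fun m f hf => by
    rw [← CatMod.naturality_apply, map_gen, Category.id_comp, gen_eq_zero f hf, map_zero]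

theorem map_aut_apply_gen {V : CatMod (Obj t) k} (φ : DeltaIrr l ⟶ V) (g : Aut n) (u : l.V) :
    (V.map (autIso g).hom).hom ((φ.app n).hom (gen l (𝟙 n) u)) =
      (φ.app n).hom (gen l (𝟙 n) (l.ρ g u)) := by
  rw [← CatMod.naturality_apply, map_gen, ← gen_aut_comp, Category.id_comp, Category.comp_id]

variable (hn : (n.card : ℕ) + 1 = m.card)

theorem exists_altSum_of_mem_killed {x : (DeltaIrr l).obj m} (hx : x ∈ killed (DeltaIrr l) m) :
    ∃ v, x = altSum l hn v :=
  eq_altSum_of_merge hn (map_merge_of_mem_killed hx hn)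

/-- Change of coordinates under an automorphism `γ` of the target. -/
theorem coord_map_aut {e e' : n ⟶ m} (he : Function.Injective e.1) (he' : Function.Injective e'.1)
    {γ : Aut m} {h : Aut n} (H : e ≫ (autIso γ).hom = (autIso h).hom ≫ e')
    (x : (DeltaIrr l).obj m) :
    coord e' he' (((DeltaIrr l).map (autIso γ).hom).hom x) = l.ρ h (coord e he x) := by
  classical
  have key : coord e' he' ∘ₗ ((DeltaIrr l).map (autIso γ).hom).hom = l.ρ h ∘ₗ coord e he := by
    refine lhom_ext fun f v => ?_
    rw [LinearMap.comp_apply, LinearMap.comp_apply, map_gen, coord_gen, coord_gen,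
      ← Equiv.sum_comp (Equiv.mulLeft h)]
    simp only [LinearMap.sum_apply, map_sum]
    refine Finset.sum_congr rfl fun g _ => ?_
    rw [Equiv.coe_mulLeft, aut_mul, Category.assoc, ← H, ← Category.assoc]
    by_cases h' : f = (autIso g).hom ≫ e
    · rw [if_pos (by rw [h']), if_pos h', map_mul]
      rfl
    · rw [if_neg fun H' => h' ((cancel_mono _).1 H'), if_neg h']
      exact (map_zero (l.ρ h)).symm
  exact congrArg (fun L => L x) key

/-- The faces `d_i` compare the translate of an alternating sum with an alternating sum. -/
theorem smul_apply_eq_of_map_altSum {γ : Aut m} {v v' : l.V}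
    (H : ((DeltaIrr l).map (autIso γ).hom).hom (altSum l hn v) = altSum l hn v') {i j : ℕ}
    (hi : i < m.card) (hj : j < m.card) {h : Aut n}
    (hij : face hn i ≫ (autIso γ).hom = (autIso h).hom ≫ face hn j) :
    (-1 : k) ^ i • l.ρ h v = (-1 : k) ^ j • v' := by
  rw [← map_smul, ← coord_altSum hn hi, ← coord_altSum hn hj, ← H,
    coord_map_aut (face_strictMono hn i).injective _ hij]

theorem map_altSum_eq {γ : Aut m} {v v' : l.V}
    (H : ∀ j : ℕ, j < m.card → ∃ i : ℕ, i < m.card ∧ ∃ h : Aut n,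
      face hn i ≫ (autIso γ).hom = (autIso h).hom ≫ face hn j ∧
        (-1 : k) ^ i • l.ρ h v = (-1 : k) ^ j • v') :
    ((DeltaIrr l).map (autIso γ).hom).hom (altSum l hn v) = altSum l hn v' := by
  refine ext_coord fun e he => ?_
  obtain ⟨j, hj⟩ := exists_not_mem_range e (by omega)
  obtain rfl := eq_face hn he hj
  obtain ⟨i, hi, h, hij, heq⟩ := H j j.isLt
  rw [coord_map_aut (face_strictMono hn i).injective _ hij, coord_altSum hn hi,
    coord_altSum hn j.isLt, map_smul, heq]

theorem altSum_mem_killed {v : l.V}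
    (H : ∀ γ : Aut m, ∃ v',
      ((DeltaIrr l).map (autIso γ).hom).hom (altSum l hn v) = altSum l hn v') :
    altSum l hn v ∈ killed (DeltaIrr l) m :=
  mem_killed_of_merge fun p hp j hj g => by
    obtain rfl : p = n := Obj.eq_of_card_eq (by omega)
    obtain ⟨v', h⟩ := H g
    rw [h, map_merge_altSum]

/-- Homomorphisms `Δ_{n+1,λ} → Δ_{n,μ}` amount to linear maps `θ : λ → μ` for which
`u ↦ ∑ (-1)^i d_i ⊗ θ u` is equivariant. -/
theorem exists_hom_ne_zero_iff {L : Rep.{u} k (Aut m)} :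
    (∃ φ : DeltaIrr L ⟶ DeltaIrr l, φ ≠ 0) ↔ ∃ θ : L.V →ₗ[k] l.V, θ ≠ 0 ∧ ∀ γ u,
      ((DeltaIrr l).map (autIso γ).hom).hom (altSum l hn (θ u)) =
        altSum l hn (θ (L.ρ γ u)) := by
  constructor
  · rintro ⟨φ, hφ⟩
    let θ : L.V →ₗ[k] l.V :=
      coord (face hn 0) (face_strictMono hn 0).injective ∘ₗ (φ.app m).hom ∘ₗ gen L (𝟙 m)
    have hθ : ∀ u, altSum l hn (θ u) = (φ.app m).hom (gen L (𝟙 m) u) := fun u => by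
      obtain ⟨v, hv⟩ := exists_altSum_of_mem_killed hn (apply_gen_mem_killed φ u)
      have := coord_altSum (l := l) hn (show 0 < (m.card : ℕ) by omega) v
      rw [pow_zero, one_smul, ← hv] at this
      rw [hv]
      exact congrArg _ this
    refine ⟨θ, fun h => hφ (hom_ext fun u => ?_), fun γ u => ?_⟩
    · rw [← hθ, h, LinearMap.zero_apply, map_zero]
      rfl
    · rw [hθ, hθ, map_aut_apply_gen]
  · rintro ⟨θ, h0, hθ⟩
    refine ⟨desc (altSum l hn ∘ₗ θ) (fun γ u => (hθ γ u).symm) fun q f hf u =>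
      mem_killed.1 (altSum_mem_killed hn fun γ => ⟨_, hθ γ u⟩) q f hf, fun h => h0 ?_⟩
    refine LinearMap.ext fun u => altSum_injective hn ?_
    rw [LinearMap.zero_apply, map_zero]
    have := desc_gen (altSum l hn ∘ₗ θ) (fun γ u => (hθ γ u).symm) (fun q f hf u =>
      mem_killed.1 (altSum_mem_killed hn fun γ => ⟨_, hθ γ u⟩) q f hf) (𝟙 m) u
    rw [h, CatMod.map_id_apply] at this
    exact this.symm

end DeltaIrr

end Killed

/-! ### The table of singular pairs -/

section Table

open Obj DeltaIrr

variable {k : Type u} [Field k]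

theorem neg_one_pow_smul_inj {M : Type*} [AddCommGroup M] [Module k M] (i : ℕ) {x y : M}
    (h : (-1 : k) ^ i • x = (-1 : k) ^ i • y) : x = y :=
  smul_right_injective M (pow_ne_zero i (neg_ne_zero.2 (one_ne_zero (α := k)))) h

section AltSumAction

variable {t : CameronType} {n m : Obj t} {μ : Rep.{u} k (Aut n)}
  (hn : (n.card : ℕ) + 1 = m.card) {γ : Aut m} {h : Aut n} {v v' : μ.V}

theorem map_rot_altSum_iff (hγ : (autIso γ).hom.1 = rot _ 1) (hh : (autIso h).hom.1 = rot _ 1) :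
    ((DeltaIrr μ).map (autIso γ).hom).hom (altSum μ hn v) = altSum μ hn v' ↔
      v' = (-1 : k) ^ (n.card : ℕ) • v ∧ μ.ρ h v = -v' := by
  have h0 : 0 < (n.card : ℕ) := n.card.pos
  constructor
  · intro H
    have h1 := smul_apply_eq_of_map_altSum hn H (i := n.card) (j := 0) (by omega) (by omega)
      (face_comp_rot_last hn hγ)
    have h2 := smul_apply_eq_of_map_altSum hn H (i := 0) (j := 1) (by omega) (by omega)
      (face_comp_rot hn hγ hh h0)
    rw [pow_zero, one_smul, map_one] at h1
    rw [pow_zero, one_smul, pow_one, neg_one_smul] at h2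
    exact ⟨h1.symm, h2⟩
  · rintro ⟨h1, h2⟩
    refine map_altSum_eq hn fun j hj => ?_
    cases j with
    | zero =>
      refine ⟨n.card, by omega, 1, face_comp_rot_last hn hγ, ?_⟩
      rw [pow_zero, one_smul, map_one, h1]
      rfl
    | succ j =>
      refine ⟨j, by omega, h, face_comp_rot hn hγ hh (by omega), ?_⟩
      rw [h2, pow_succ, mul_neg_one, neg_smul, smul_neg]

theorem map_rev_altSum_iff (hγ : (autIso γ).hom.1 = Fin.rev) (hh : (autIso h).hom.1 = Fin.rev) :
    ((DeltaIrr μ).map (autIso γ).hom).hom (altSum μ hn v) = altSum μ hn v' ↔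
      μ.ρ h v = (-1 : k) ^ (n.card : ℕ) • v' := by
  constructor
  · intro H
    have h1 := smul_apply_eq_of_map_altSum hn H (i := 0) (j := n.card - 0) (by omega) (by omega)
      (face_comp_rev hn hγ hh (by omega))
    rwa [pow_zero, one_smul, Nat.sub_zero] at h1
  · intro h1
    refine map_altSum_eq hn fun j hj => ⟨n.card - j, by omega, h, ?_, ?_⟩
    · rw [face_comp_rev hn hγ hh (by omega)]
      congr 2
      omega
    · have : ((-1 : k) ^ ((n.card : ℕ) - j)) * (-1) ^ (n.card : ℕ) = (-1) ^ j := by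
        rw [← pow_add, show (n.card : ℕ) - j + n.card = 2 * ((n.card : ℕ) - j) + j by omega,
          pow_add, pow_mul, neg_one_sq, one_pow, one_mul]
      rw [h1, smul_smul, this]

theorem map_swap_altSum {j : ℕ} {hj : j + 1 < m.card} (hγ : (autIso γ).hom.1 = swapSucc _ j hj)
    (hv : ∀ (i : ℕ) (hi : i + 1 < n.card) (h : Aut n),
      (autIso h).hom.1 = swapSucc _ i hi → μ.ρ h v = -v)
    (hex : ∀ (i : ℕ) (hi : i + 1 < n.card), ∃ h : Aut n, (autIso h).hom.1 = swapSucc _ i hi) :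
    ((DeltaIrr μ).map (autIso γ).hom).hom (altSum μ hn v) = altSum μ hn (-v) := by
  refine map_altSum_eq hn fun i hi => ?_
  rcases Nat.lt_trichotomy i j with h' | rfl | h'
  · obtain ⟨j, rfl⟩ : ∃ j', j = j' + 1 := ⟨j - 1, by omega⟩
    obtain ⟨h, hh⟩ := hex j (by omega)
    exact ⟨i, hi, h, face_comp_swap_of_lt hn hγ hh (by omega), by rw [hv _ _ h hh]⟩
  · refine ⟨i + 1, hj, 1, face_comp_swap_succ hn hγ, ?_⟩
    rw [map_one, pow_succ, mul_neg_one, neg_smul, smul_neg]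
    rfl
  · rcases Nat.lt_or_ge (j + 1) i with h'' | h''
    · obtain ⟨h, hh⟩ := hex j (by omega)
      exact ⟨i, hi, h, face_comp_swap_of_gt hn hγ hh h'', by rw [hv _ _ h hh]⟩
    · obtain rfl : i = j + 1 := by omega
      refine ⟨j, by omega, 1, face_comp_swap_self hn hγ, ?_⟩
      rw [map_one, pow_succ, mul_neg_one, neg_smul, smul_neg, neg_neg]
      rfl

theorem eq_neg_of_map_swap_altSum {j : ℕ} {hj : j + 1 < m.card}
    (hγ : (autIso γ).hom.1 = swapSucc _ j hj)
    (H : ((DeltaIrr μ).map (autIso γ).hom).hom (altSum μ hn v) = altSum μ hn v') : v' = -v := by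
  have h1 := smul_apply_eq_of_map_altSum hn H (by omega) hj (face_comp_swap_self hn hγ)
  rw [map_one, pow_succ, mul_neg_one, neg_smul, ← smul_neg] at h1
  have h2 : v = -v' := neg_one_pow_smul_inj j h1
  rw [h2, neg_neg]

theorem apply_eq_of_map_swap_altSum {j : ℕ} {hj : j + 1 < m.card}
    (hγ : (autIso γ).hom.1 = swapSucc _ j hj) {hj' : j + 1 < n.card}
    (hh : (autIso h).hom.1 = swapSucc _ j hj')
    (H : ((DeltaIrr μ).map (autIso γ).hom).hom (altSum μ hn v) = altSum μ hn v') :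
    μ.ρ h v = v' :=
  neg_one_pow_smul_inj (n.card : ℕ) <| smul_apply_eq_of_map_altSum hn H (by omega) (by omega)
    (face_comp_swap_of_gt hn hγ hh hj')

end AltSumAction

section Scalars

variable {t : CameronType} {N : Obj t} {l : Rep.{u} k (Aut N)}

/-- Joint eigenvectors of the generators are joint eigenvectors of the group. -/
theorem exists_smul_of_gen {u : l.V}
    (h : ∀ g, IsGen t (autIso g).hom.1 → ∃ c : k, l.ρ g u = c • u) (g : Aut N) :
    ∃ c : k, l.ρ g u = c • u := by
  refine aut_induction (P := fun g => ∃ c : k, l.ρ g u = c • u) ⟨1, ?_⟩ ?_ h g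
  · rw [map_one, one_smul]
    rfl
  · rintro g h ⟨c, hc⟩ ⟨d, hd⟩
    refine ⟨d * c, ?_⟩
    rw [map_mul, Module.End.mul_apply, hd, map_smul, hc, smul_smul]

theorem ActsBy.apply_eq {s : Fin N.card → Fin N.card} {c : k} (h : ActsBy l s c) {g : Aut N}
    (hg : (autIso g).hom.1 = s) (v : l.V) : l.ρ g v = c • v := by
  obtain ⟨g', hg', h⟩ := h
  rw [aut_ext (hg.trans hg'.symm), h]

/-- If a joint eigenvector of the generators in an irreducible representation has eigenvalue `c`
for `g`, then `g` acts by `c`. -/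
theorem ActsBy.of_eigenvector (hl : l.ρ.IsIrreducible) {u : l.V} (hu : u ≠ 0)
    (h : ∀ g, IsGen t (autIso g).hom.1 → ∃ c : k, l.ρ g u = c • u) {g : Aut N} {c : k}
    (hg : l.ρ g u = c • u) : ActsBy l (autIso g).hom.1 c :=
  ⟨g, rfl, Rep.apply_eq_smul hl hu (exists_smul_of_gen h) hg⟩

theorem isSign_of_eigenvector {N : Obj .FA} {l : Rep.{u} k (Aut N)} (hl : l.ρ.IsIrreducible)
    {u : l.V} (hu : u ≠ 0)
    (h : ∀ (j : ℕ) (hj : j + 1 < N.card) (g : Aut N), (autIso g).hom.1 = swapSucc _ j hj →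
      l.ρ g u = -u) : IsSign l := by
  have hgen : ∀ g : Aut N, IsGen .FA (autIso g).hom.1 → ∃ c : k, l.ρ g u = c • u := by
    rintro g ⟨j, hj, hg⟩
    exact ⟨-1, by rw [h j hj g hg, neg_one_smul]⟩
  intro s
  refine ActsBy.of_eigenvector (g := permAut N s) hl hu hgen ?_
  refine perm_induction
    (P := fun s => l.ρ (permAut N s) u = ((Equiv.Perm.sign s : ℤ) : k) • u) ?_ ?_ ?_ s
  · simp
  · intro a b ha hb
    rw [map_mul, map_mul, Module.End.mul_apply, hb, map_smul, ha, smul_smul, map_mul, Units.val_mul,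
      Int.cast_mul, mul_comm]
  · intro j hj
    rw [h j hj _ rfl, swapSucc, Equiv.Perm.sign_swap (by simp)]
    simp

theorem IsSign.apply_swap {N : Obj .FA} {l : Rep.{u} k (Aut N)} (hl : IsSign l) {j : ℕ}
    {hj : j + 1 < N.card} {g : Aut N} (hg : (autIso g).hom.1 = swapSucc _ j hj) (v : l.V) :
    l.ρ g v = -v := by
  rw [(hl (swapSucc _ j hj)).apply_eq hg, swapSucc, Equiv.Perm.sign_swap (by simp)]
  simp

/-- An involution has an eigenvector with eigenvalue `1` or `-1`. -/
theorem exists_eigenvector_of_mul_self (hl : l.ρ.IsIrreducible) {g : Aut N} (hg : g * g = 1) :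
    ∃ (ε : k) (u : l.V), (ε = 1 ∨ ε = -1) ∧ u ≠ 0 ∧ l.ρ g u = ε • u := by
  obtain ⟨u, hu⟩ := Rep.exists_ne_zero hl
  have hgg : l.ρ g (l.ρ g u) = u := by
    rw [← Module.End.mul_apply, ← map_mul, hg, map_one]
    rfl
  by_cases h : u + l.ρ g u = 0
  · exact ⟨-1, u, Or.inr rfl, hu, by rw [neg_one_smul, eq_neg_of_add_eq_zero_right h]⟩
  · refine ⟨1, _, Or.inl rfl, h, ?_⟩
    rw [map_add, hgg, one_smul, add_comm]

end Scalars

variable {t : CameronType} {n : Obj t}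

theorem next_card : (n.card : ℕ) + 1 = n.next.card := rfl

theorem IsSingularPair.singularTable {l : Rep.{u} k (Aut n.next)} {μ : Rep.{u} k (Aut n)}
    (hl : l.ρ.IsIrreducible) (hμ : μ.ρ.IsIrreducible) (h : IsSingularPair l μ) :
    SingularTable l μ := by
  obtain ⟨θ, h0, hθ⟩ := (exists_hom_ne_zero_iff next_card).1 h
  have hinj : Function.Injective θ := by
    have hker : ∀ g, ∀ v ∈ LinearMap.ker θ, l.ρ g v ∈ LinearMap.ker θ := fun g v hv => by
      rw [LinearMap.mem_ker] at hv ⊢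
      refine altSum_injective next_card ?_
      rw [← hθ, hv, map_zero, map_zero]
    rcases Rep.eq_bot_or_eq_top hl _ hker with h' | h'
    · exact LinearMap.ker_eq_bot.1 h'
    · exact absurd (LinearMap.ker_eq_top.1 h') h0
  have hne : ∀ {u}, u ≠ 0 → θ u ≠ 0 := fun hu h => hu (hinj (by rw [h, map_zero]))
  cases t with
  | OA => trivial
  | FA =>
    obtain ⟨u, hu⟩ := Rep.exists_ne_zero hl
    have hu' : ∀ (j : ℕ) (hj : j + 1 < n.next.card) (g : Aut n.next),
        (autIso g).hom.1 = swapSucc _ j hj → θ (l.ρ g u) = -θ u := fun j hj g hg =>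
      eq_neg_of_map_swap_altSum next_card hg (hθ g u)
    refine ⟨isSign_of_eigenvector hl hu fun j hj g hg => hinj ?_,
      isSign_of_eigenvector hμ (hne hu) fun j hj g hg => ?_⟩
    · rw [hu' j hj g hg, map_neg]
    · have hj' : j + 1 < n.next.card := by rw [← next_card]; omega
      rw [← hu' j hj' (permAut _ (swapSucc _ j hj')) rfl]
      exact apply_eq_of_map_swap_altSum next_card (permAut_hom _ _) hg (hθ _ u)
  | CA =>
    obtain ⟨u, hu⟩ := Rep.exists_ne_zero hl
    let γ := rotAut n.next (isMor_rot_CA _) 1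
    let h := rotAut n (isMor_rot_CA _) 1
    obtain ⟨h1, h2⟩ := (map_rot_altSum_iff (γ := γ) (h := h) next_card rfl rfl).1 (hθ γ u)
    have h3 : l.ρ γ u = (-1 : k) ^ (n.card : ℕ) • u := hinj (by rw [h1, map_smul])
    have h4 : μ.ρ h (θ u) = (-1 : k) ^ ((n.card : ℕ) + 1) • θ u := by
      rw [h2, h1, pow_succ, mul_neg_one, neg_smul]
    refine ⟨ActsBy.of_eigenvector hl hu (fun g hg => ?_) h3,
      ActsBy.of_eigenvector hμ (hne hu) (fun g hg => ?_) h4⟩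
    · exact ⟨_, by rw [show g = γ from aut_ext hg, h3]⟩
    · exact ⟨_, by rw [show g = h from aut_ext hg, h4]⟩
  | BA =>
    let γ := revAut n.next (isMor_rev_BA _)
    let h := revAut n (isMor_rev_BA _)
    obtain ⟨ε, u, hε, hu, h3⟩ := exists_eigenvector_of_mul_self hl (g := γ)
      (aut_ext (by rw [aut_mul]; exact rev_comp_rev _))
    have h4 := (map_rev_altSum_iff (γ := γ) (h := h) next_card rfl rfl).1 (hθ γ u)
    rw [h3, map_smul, smul_smul] at h4
    refine ⟨ε, hε, ActsBy.of_eigenvector hl hu (fun g hg => ?_) h3,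
      ActsBy.of_eigenvector hμ (hne hu) (fun g hg => ?_) h4⟩
    · exact ⟨_, by rw [show g = γ from aut_ext hg, h3]⟩
    · exact ⟨_, by rw [show g = h from aut_ext hg, h4]⟩
  | SA =>
    let γ := rotAut n.next (isMor_rot_SA _) 1
    let h := rotAut n (isMor_rot_SA _) 1
    let γ' := revAut n.next (isMor_rev_SA _)
    let h' := revAut n (isMor_rev_SA _)
    obtain ⟨ε, u, hε, hu, h5⟩ := exists_eigenvector_of_mul_self hl (g := γ')
      (aut_ext (by rw [aut_mul]; exact rev_comp_rev _))
    obtain ⟨h1, h2⟩ := (map_rot_altSum_iff (γ := γ) (h := h) next_card rfl rfl).1 (hθ γ u)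
    have h3 : l.ρ γ u = (-1 : k) ^ (n.card : ℕ) • u := hinj (by rw [h1, map_smul])
    have h4 : μ.ρ h (θ u) = (-1 : k) ^ ((n.card : ℕ) + 1) • θ u := by
      rw [h2, h1, pow_succ, mul_neg_one, neg_smul]
    have h6 := (map_rev_altSum_iff (γ := γ') (h := h') next_card rfl rfl).1 (hθ γ' u)
    rw [h5, map_smul, smul_smul] at h6
    have hl' : ∀ g : Aut n.next, IsGen .SA (autIso g).hom.1 → ∃ c : k, l.ρ g u = c • u := by
      rintro g (hg | hg)
      · exact ⟨_, by rw [show g = γ from aut_ext hg, h3]⟩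
      · exact ⟨_, by rw [show g = γ' from aut_ext hg, h5]⟩
    have hμ' : ∀ g : Aut n, IsGen .SA (autIso g).hom.1 → ∃ c : k, μ.ρ g (θ u) = c • θ u := by
      rintro g (hg | hg)
      · exact ⟨_, by rw [show g = h from aut_ext hg, h4]⟩
      · exact ⟨_, by rw [show g = h' from aut_ext hg, h6]⟩
    exact ⟨ActsBy.of_eigenvector hl hu hl' h3, ActsBy.of_eigenvector hμ (hne hu) hμ' h4, ε, hε,
      ActsBy.of_eigenvector hl hu hl' h5, ActsBy.of_eigenvector hμ (hne hu) hμ' h6⟩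

/-- In a pair of the table, each generator of `G_{n+1}` acts on `λ` by the scalar by which it acts
on the alternating sums of faces in `Δ_{n,μ}(n+1)`. -/
theorem SingularTable.exists_smul {l : Rep.{u} k (Aut n.next)} {μ : Rep.{u} k (Aut n)}
    (h : SingularTable l μ) (v : μ.V) {γ : Aut n.next} (hγ : IsGen t (autIso γ).hom.1) :
    ∃ c : k, (∀ u, l.ρ γ u = c • u) ∧
      ((DeltaIrr μ).map (autIso γ).hom).hom (altSum μ next_card v) = c • altSum μ next_card v := by
  have hrot : ∀ g : Aut n, (autIso g).hom.1 = rot _ 1 → (autIso γ).hom.1 = rot _ 1 →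
      ActsBy l (rot _ 1) ((-1 : k) ^ (n.card : ℕ)) →
      ActsBy μ (rot _ 1) ((-1 : k) ^ ((n.card : ℕ) + 1)) → _ := fun g hg hγ h1 h2 =>
    (⟨_, h1.apply_eq hγ, by
      rw [← map_smul]
      refine (map_rot_altSum_iff next_card hγ hg).2 ⟨rfl, ?_⟩
      rw [h2.apply_eq hg, pow_succ, mul_neg_one, neg_smul]⟩ : ∃ c : k, (∀ u, l.ρ γ u = c • u) ∧
      ((DeltaIrr μ).map (autIso γ).hom).hom (altSum μ next_card v) = c • altSum μ next_card v)
  have hrev : ∀ g : Aut n, (autIso g).hom.1 = Fin.rev → (autIso γ).hom.1 = Fin.rev → ∀ ε : k,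
      ActsBy l Fin.rev ε → ActsBy μ Fin.rev ((-1 : k) ^ (n.card : ℕ) * ε) → _ :=
    fun g hg hγ ε h1 h2 => (⟨_, h1.apply_eq hγ, by
      rw [← map_smul]
      refine (map_rev_altSum_iff next_card hγ hg).2 ?_
      rw [h2.apply_eq hg, smul_smul]⟩ : ∃ c : k, (∀ u, l.ρ γ u = c • u) ∧
      ((DeltaIrr μ).map (autIso γ).hom).hom (altSum μ next_card v) = c • altSum μ next_card v)
  cases t with
  | OA => exact hγ.elim
  | FA =>
    obtain ⟨j, hj, hγ⟩ := hγ
    refine ⟨-1, fun u => by rw [h.1.apply_swap hγ, neg_one_smul], ?_⟩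
    rw [← map_smul, neg_one_smul]
    exact map_swap_altSum next_card hγ (fun i hi g hg => h.2.apply_swap hg v)
      fun i hi => ⟨permAut n (swapSucc _ i hi), rfl⟩
  | CA => exact hrot (rotAut n (isMor_rot_CA _) 1) rfl hγ h.1 h.2
  | BA =>
    obtain ⟨ε, -, h1, h2⟩ := h
    exact hrev (revAut n (isMor_rev_BA _)) rfl hγ ε h1 h2
  | SA =>
    obtain ⟨h1, h2, ε, -, h3, h4⟩ := h
    rcases hγ with hγ | hγ
    · exact hrot (rotAut n (isMor_rot_SA _) 1) rfl hγ h1 h2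
    · exact hrev (revAut n (isMor_rev_SA _)) rfl hγ ε h3 h4

theorem SingularTable.isSingularPair {l : Rep.{u} k (Aut n.next)} {μ : Rep.{u} k (Aut n)}
    (hl : l.ρ.IsIrreducible) (hμ : μ.ρ.IsIrreducible) (h : SingularTable l μ) :
    IsSingularPair l μ := by
  obtain ⟨u, hu⟩ := Rep.exists_ne_zero hl
  obtain ⟨v, hv⟩ := Rep.exists_ne_zero hμ
  have key : ∀ γ : Aut n.next, ∃ c : k, (∀ u, l.ρ γ u = c • u) ∧
      ((DeltaIrr μ).map (autIso γ).hom).hom (altSum μ next_card v) = c • altSum μ next_card v := by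
    refine aut_induction ⟨1, fun u => ?_, ?_⟩ ?_ fun γ hγ => h.exists_smul v hγ
    · rw [map_one, one_smul]
      rfl
    · rw [one_smul]
      exact CatMod.map_id_apply _ _
    · rintro a b ⟨c, hc, hc'⟩ ⟨d, hd, hd'⟩
      refine ⟨d * c, fun u => ?_, ?_⟩
      · rw [map_mul, Module.End.mul_apply, hd, map_smul, hc, smul_smul]
      · rw [aut_mul, CatMod.map_comp_apply, hd', map_smul, hc', smul_smul]
  obtain ⟨f, hf⟩ : ∃ f : Module.Dual k l.V, f u ≠ 0 := by
    by_contra! H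
    exact hu ((Module.forall_dual_apply_eq_zero_iff k u).1 H)
  refine (exists_hom_ne_zero_iff next_card).2 ⟨LinearMap.toSpanSingleton k _ v ∘ₗ f, fun H => ?_,
    fun γ w => ?_⟩
  · have := congrArg (fun L => L u) H
    exact (smul_ne_zero hf hv) this
  · obtain ⟨c, hc, hc'⟩ := key γ
    rw [hc]
    simp only [LinearMap.comp_apply, LinearMap.toSpanSingleton_apply, map_smul]
    rw [hc']
    exact smul_comm _ _ _

theorem isSingularPair_iff {l : Rep.{u} k (Aut n.next)} {μ : Rep.{u} k (Aut n)}
    (hl : l.ρ.IsIrreducible) (hμ : μ.ρ.IsIrreducible) : IsSingularPair l μ ↔ SingularTable l μ :=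
  ⟨fun h => h.singularTable hl hμ, fun h => h.isSingularPair hl hμ⟩

/-- `μ` is singular if and only if it is the second entry of a singular pair: the space of elements
of `Δ_{n,μ}(n+1)` killed by all non-injective morphisms contains an irreducible representation. -/
theorem isSingular_iff_exists [CharZero k] {μ : Rep.{u} k (Aut n)} :
    IsSingular μ ↔ ∃ l : Rep.{u} k (Aut n.next), l.ρ.IsIrreducible ∧ IsSingularPair l μ := by
  rw [IsSingular, exists_delta_hom_ne_zero_iff]
  constructor
  · intro h
    obtain ⟨l, hl, θ, h0, hθ, hW⟩ := Subrepresentation.exists_irreducible h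
    refine ⟨l, hl, desc θ hθ fun m f hf u => mem_killed.1 (hW u) m f hf, fun H => h0 ?_⟩
    refine LinearMap.ext fun u => ?_
    have := desc_gen θ hθ (fun m f hf u => mem_killed.1 (hW u) m f hf) (𝟙 _) u
    rw [H, CatMod.map_id_apply] at this
    exact this.symm
  · rintro ⟨l, -, φ, hφ⟩ h
    refine hφ (hom_ext fun u => ?_)
    have := apply_gen_mem_killed φ u
    rw [h] at this
    exact (Submodule.mem_bot k).1 this

end Table

/-! ### Submodules and tops of standard modules -/

section Standard

open Obj DeltaIrr

variable {k : Type u} [Field k] {t : CameronType} {n m : Obj t}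

theorem Rep.nonempty_iso_of_bijective {G : Type} [Group G] {A B : Rep.{u} k G}
    (f : A.V →ₗ[k] B.V) (hf : Function.Bijective f) (h : ∀ g v, f (A.ρ g v) = B.ρ g (f v)) :
    Nonempty (A ≅ B) :=
  ⟨Rep.mkIso (Representation.Equiv.mk (LinearEquiv.ofBijective f hf) fun g =>
    LinearMap.ext fun v => h g v)⟩

theorem autRep_nonempty_iso {V W : CatMod (Obj t) k} (e : V ≅ W) (n : Obj t) :
    Nonempty (autRep V n ≅ autRep W n) :=
  Rep.nonempty_iso_of_bijective (A := autRep V n) (B := autRep W n) (e.hom.app n).hom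
    (CatMod.bijective_of_iso e n) fun g v => CatMod.naturality_apply e.hom (autIso g).hom v

namespace DeltaIrr

variable {l : Rep.{u} k (Aut n)}

theorem eq_zero_of_card_lt (h : (m.card : ℕ) < n.card) (x : (DeltaIrr l).obj m) : x = 0 :=
  ext_coord fun e he => absurd (card_le_of_injective e he.injective) (by omega)

theorem exists_eq_gen_id (x : (DeltaIrr l).obj n) : ∃ v, x = gen l (𝟙 n) v := by
  refine ⟨coord (𝟙 n) Function.injective_id x, ext_coord fun e he => ?_⟩
  obtain rfl : e = 𝟙 n := Obj.hom_ext (eq_id_of_strictMono he)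
  rw [coord_gen_self he]

theorem gen_id_injective : Function.Injective (gen l (𝟙 n)) := fun v w h => by
  have he : StrictMono (𝟙 n : n ⟶ n).1 := strictMono_id
  rw [← coord_gen_self he v, h, coord_gen_self he]

theorem eq_top_of_gen_mem {S : Submod (DeltaIrr l)} (h : ∀ v, gen l (𝟙 n) v ∈ S.carrier n) :
    S = ⊤ := by
  refine Submod.eq_top_iff_carrier.2 fun m => Submodule.eq_top_iff'.2 fun x => ?_
  have := Fintype.ofFinite {e : n ⟶ m // StrictMono e.1}
  rw [eq_sum_gen_coord x]
  refine Submodule.sum_mem _ fun e _ => ?_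
  have := S.map_mem e.1 (h (coord e.1 e.2.injective x))
  rwa [Submodule.mem_comap, map_gen, Category.id_comp] at this

/-- A proper submodule of `Δ_{n,λ}` vanishes at `[n]`, because `Δ_{n,λ}([n]) = λ` is irreducible and
generates. -/
theorem carrier_eq_bot_of_ne_top (hl : l.ρ.IsIrreducible) {S : Submod (DeltaIrr l)} (hS : S ≠ ⊤) :
    S.carrier n = ⊥ := by
  have hN : ∀ g, ∀ v ∈ (S.carrier n).comap (gen l (𝟙 n)),
      l.ρ g v ∈ (S.carrier n).comap (gen l (𝟙 n)) := fun g v hv => by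
    have := S.map_mem (autIso g).hom hv
    rw [Submodule.mem_comap, map_gen, Category.id_comp] at this
    rw [Submodule.mem_comap, ← gen_aut_comp, Category.comp_id]
    exact this
  rcases Rep.eq_bot_or_eq_top hl _ hN with h | h
  · refine (Submodule.eq_bot_iff _).2 fun x hx => ?_
    obtain ⟨v, rfl⟩ := exists_eq_gen_id x
    have : v ∈ (S.carrier n).comap (gen l (𝟙 n)) := hx
    rw [h, Submodule.mem_bot] at this
    rw [this, map_zero]
  · refine absurd (eq_top_of_gen_mem fun v => ?_) hS
    have : v ∈ (S.carrier n).comap (gen l (𝟙 n)) := by rw [h]; trivial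
    exact this

theorem le_colon_of_ne_top (hl : l.ρ.IsIrreducible) {S : Submod (DeltaIrr l)} (hS : S ≠ ⊤) :
    S ≤ Submod.colon (DeltaIrr l) n ⊥ := fun m x hx => Submod.mem_colon.2 fun f => by
  rw [← carrier_eq_bot_of_ne_top hl hS]
  exact S.map_mem f hx

theorem isCoatom_colon (hl : l.ρ.IsIrreducible) : IsCoatom (Submod.colon (DeltaIrr l) n ⊥) := by
  refine ⟨fun h => ?_, fun S hS => by_contra fun h => hS.not_ge (le_colon_of_ne_top hl h)⟩
  obtain ⟨v, hv⟩ := Rep.exists_ne_zero hl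
  have : gen l (𝟙 n) v ∈ (Submod.colon (DeltaIrr l) n ⊥).carrier n := by
    rw [h, Submod.carrier_top]; trivial
  have := (Submodule.mem_bot k).1 (Submod.mem_colon.1 this (𝟙 n))
  rw [CatMod.map_id_apply] at this
  exact hv (gen_id_injective (this.trans (map_zero _).symm))

/-- `Δ_{n,λ}` has a unique maximal submodule, which consists of the elements that every morphism to
`[n]` kills. -/
theorem radical_eq (hl : l.ρ.IsIrreducible) :
    radical (DeltaIrr l) = Submod.colon (DeltaIrr l) n ⊥ := by
  have : {S : Submod (DeltaIrr l) | IsCoatom S} = {Submod.colon (DeltaIrr l) n ⊥} := by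
    refine Set.eq_singleton_iff_unique_mem.2 ⟨isCoatom_colon hl, fun S hS => ?_⟩
    exact (hS.le_iff.1 (le_colon_of_ne_top hl hS.1)).resolve_left (isCoatom_colon hl).1 |>.symm
  rw [radical, this]
  exact sInf_singleton

theorem simple_top (hl : l.ρ.IsIrreducible) : Simple (top (DeltaIrr l)) :=
  Submod.simple_quotient (by rw [radical_eq hl]; exact isCoatom_colon hl)

/-- Every simple module to which `Δ_{n,λ}` maps nontrivially is the top of `Δ_{n,λ}`. -/
theorem nonempty_top_iso (hl : l.ρ.IsIrreducible) {V : CatMod (Obj t) k} (hV : Simple V)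
    {φ : DeltaIrr l ⟶ V} (hφ : φ ≠ 0) :
    Nonempty (top (DeltaIrr l) ≅ V) := by
  obtain ⟨-, hV⟩ := CatMod.simple_iff.1 hV
  obtain ⟨v, hv⟩ : ∃ v, (φ.app n).hom (gen l (𝟙 n) v) ≠ 0 := by
    by_contra! H
    refine hφ (hom_ext fun v => ?_)
    rw [H v]
    rfl
  have hcolon : Submod.colon V n ⊥ = ⊥ := (hV _).resolve_right fun h => hv <| by
    have : (φ.app n).hom (gen l (𝟙 n) v) ∈ (Submod.colon V n ⊥).carrier n := by
      rw [h, Submod.carrier_top]; trivial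
    have := (Submodule.mem_bot k).1 (Submod.mem_colon.1 this (𝟙 n))
    rwa [CatMod.map_id_apply] at this
  have hrange : Submod.range φ = ⊤ := (hV _).resolve_left fun h => hv <| by
    have : (φ.app n).hom (gen l (𝟙 n) v) ∈ (Submod.range φ).carrier n := ⟨_, rfl⟩
    rw [h, Submod.carrier_bot] at this
    exact (Submodule.mem_bot k).1 this
  have hker : ∀ X, ∀ x ∈ (radical (DeltaIrr l)).carrier X, (φ.app X).hom x = 0 := by
    intro X x hx
    rw [radical_eq hl] at hx
    have : (φ.app X).hom x ∈ (Submod.colon V n ⊥).carrier X := Submod.mem_colon.2 fun f => by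
      rw [← CatMod.naturality_apply, (Submodule.mem_bot k).1 (Submod.mem_colon.1 hx f), map_zero]
      exact zero_mem _
    rw [hcolon, Submod.carrier_bot] at this
    exact (Submodule.mem_bot k).1 this
  refine CatMod.nonempty_iso_of_bijective ((radical (DeltaIrr l)).lift φ hker) fun X =>
    ⟨(injective_iff_map_eq_zero _).2 fun y hy => ?_, fun y => ?_⟩
  · obtain ⟨x, rfl⟩ := (radical (DeltaIrr l)).proj_surjective X y
    have hy : (φ.app X).hom x = 0 := hy
    refine (Submod.proj_eq_zero_iff _).2 ?_
    by_contra hx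
    -- otherwise the kernel of `φ` is not contained in the unique maximal submodule
    have htop : Submod.comap φ ⊥ = ⊤ := by
      by_contra h
      refine hx ?_
      rw [radical_eq hl]
      refine le_colon_of_ne_top hl h X ?_
      change (φ.app X).hom x ∈ (⊥ : Submod V).carrier X
      rw [hy]
      exact zero_mem _
    have : gen l (𝟙 n) v ∈ (Submod.comap φ ⊥).carrier n := by
      rw [htop, Submod.carrier_top]; trivial
    have : (φ.app n).hom (gen l (𝟙 n) v) ∈ (⊥ : Submod V).carrier n := this
    rw [Submod.carrier_bot] at this
    exact hv ((Submodule.mem_bot k).1 this)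
  · have : y ∈ (Submod.range φ).carrier X := by rw [hrange, Submod.carrier_top]; trivial
    obtain ⟨x, hx⟩ := this
    exact ⟨((radical (DeltaIrr l)).proj.app X).hom x, hx⟩

/-- `λ` is recovered as the value at `[n]` of the top of `Δ_{n,λ}`. -/
theorem nonempty_iso_autRep_top (hl : l.ρ.IsIrreducible) :
    Nonempty (l ≅ autRep (top (DeltaIrr l)) n) := by
  let π := (radical (DeltaIrr l)).proj
  refine Rep.nonempty_iso_of_bijective (B := autRep (top (DeltaIrr l)) n)
    ((π.app n).hom ∘ₗ gen l (𝟙 n)) ⟨(injective_iff_map_eq_zero _).2 fun v hv => ?_, fun y => ?_⟩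
    fun g v => (map_aut_apply_gen π g v).symm
  · have hv := (Submod.proj_eq_zero_iff _).1 hv
    rw [radical_eq hl] at hv
    have := (Submodule.mem_bot k).1 (Submod.mem_colon.1 hv (𝟙 n))
    rw [CatMod.map_id_apply] at this
    exact gen_id_injective (this.trans (map_zero _).symm)
  · obtain ⟨x, rfl⟩ := (radical (DeltaIrr l)).proj_surjective n y
    obtain ⟨v, rfl⟩ := exists_eq_gen_id x
    exact ⟨v, rfl⟩

theorem nonempty_top_iso_of_iso (hl : l.ρ.IsIrreducible) {l' : Rep.{u} k (Aut n)}
    (hl' : l'.ρ.IsIrreducible) (e : l ≅ l') :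
    Nonempty (top (DeltaIrr l) ≅ top (DeltaIrr l')) := by
  let π := (radical (DeltaIrr l')).proj
  let i := Representation.equivOfIso e
  let ψ : l.V →ₗ[k] (top (DeltaIrr l')).obj n := (π.app n).hom ∘ₗ gen l' (𝟙 n) ∘ₗ i.toLinearMap
  have hψ : ∀ g v, ψ (l.ρ g v) = ((top (DeltaIrr l')).map (autIso g).hom).hom (ψ v) := fun g v =>
    (congrArg (fun w => (π.app n).hom (gen l' (𝟙 n) w))
      (congrArg (fun L => L v) (i.isIntertwining' g))).trans (map_aut_apply_gen π g (i v)).symm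
  have h0 : ∀ (m : Obj t) (f : n ⟶ m), ¬ Function.Injective f.1 →
      ∀ v, ((top (DeltaIrr l')).map f).hom (ψ v) = 0 := fun m f hf v =>
    mem_killed.1 (apply_gen_mem_killed π (i v)) m f hf
  refine nonempty_top_iso hl (simple_top hl') (φ := desc ψ hψ h0) fun H => ?_
  obtain ⟨w, hw⟩ := Rep.exists_ne_zero hl'
  obtain ⟨v, rfl⟩ := i.toLinearEquiv.surjective w
  refine hw ?_
  have h1 := desc_gen ψ hψ h0 (𝟙 n) v
  rw [H, CatMod.map_id_apply] at h1
  have h2 := (Submod.proj_eq_zero_iff (radical (DeltaIrr l'))).1 h1.symm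
  rw [radical_eq hl'] at h2
  have := (Submodule.mem_bot k).1 (Submod.mem_colon.1 h2 (𝟙 n))
  rw [CatMod.map_id_apply] at this
  exact gen_id_injective (this.trans (map_zero _).symm)

/-- A proper nonzero submodule of `Δ_{n,λ}` contains a nonzero element of `Δ_{n,λ}(n+1)` killed by
all non-injective morphisms: the smallest `m` at which the submodule does not vanish is `n+1`, since
the degeneracies kill its value at `[m]`. -/
theorem exists_mem_killed (hl : l.ρ.IsIrreducible) {S : Submod (DeltaIrr l)} (h0 : S ≠ ⊥)
    (h1 : S ≠ ⊤) :
    ∃ x ∈ S.carrier n.next, x ≠ 0 ∧ x ∈ killed (DeltaIrr l) n.next := by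
  classical
  have hex : ∃ N : ℕ, ∃ m : Obj t, (m.card : ℕ) = N ∧ ∃ x ∈ S.carrier m, x ≠ 0 := by
    obtain ⟨m, h⟩ := Submod.exists_ne_zero_of_ne_bot h0
    exact ⟨_, m, rfl, h⟩
  obtain ⟨m, hm, x, hx, hx0⟩ := Nat.find_spec hex
  have hmin : ∀ p : Obj t, (p.card : ℕ) < m.card → ∀ y ∈ S.carrier p, y = 0 := by
    intro p hp y hy
    by_contra hy0
    exact Nat.find_min hex (hm ▸ hp) ⟨p, rfl, y, hy, hy0⟩
  have hkill : x ∈ killed (DeltaIrr l) m := mem_killed_of_merge fun p hp j hj g =>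
    hmin p (by omega) _ (S.map_mem _ (S.map_mem _ hx))
  have hmn : (m.card : ℕ) = n.card + 1 := by
    rcases Nat.lt_trichotomy m.card (n.card + 1) with h | h | h
    · exfalso
      rcases Nat.lt_or_ge m.card n.card with h' | h'
      · exact hx0 (eq_zero_of_card_lt h' x)
      · obtain rfl : m = n := Obj.eq_of_card_eq (by omega)
        rw [carrier_eq_bot_of_ne_top hl h1] at hx
        exact hx0 ((Submodule.mem_bot k).1 hx)
    · exact h
    · obtain ⟨p, hp⟩ := exists_card_add_one_eq (m := m) (by omega)
      exact absurd (eq_zero_of_merge hp (by omega) (map_merge_of_mem_killed hkill hp)) hx0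
  obtain rfl : m = n.next := Obj.eq_of_card_eq hmn
  exact ⟨x, hx, hx0, hkill⟩

/-- `Δ_{n,λ}` is simple if `λ` is regular. -/
theorem simple_of_not_isSingular (hl : l.ρ.IsIrreducible) (h : ¬ IsSingular l) :
    Simple (DeltaIrr l) := by
  obtain ⟨v, hv⟩ := Rep.exists_ne_zero hl
  refine CatMod.simple_iff.2 ⟨⟨n, gen l (𝟙 n) v, fun H => hv ?_⟩, fun S => ?_⟩
  · exact gen_id_injective (H.trans (map_zero _).symm)
  · by_contra! H
    obtain ⟨x, -, hx0, hx⟩ := exists_mem_killed hl H.1 H.2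
    refine h (exists_delta_hom_ne_zero_iff.2 fun hb => hx0 ?_)
    rw [hb] at hx
    exact (Submodule.mem_bot k).1 hx

end DeltaIrr

theorem SingularTable.exists_smul_right {l : Rep.{u} k (Aut n.next)} {μ : Rep.{u} k (Aut n)}
    (h : SingularTable l μ) (v : μ.V) (g : Aut n) : ∃ c : k, μ.ρ g v = c • v := by
  refine exists_smul_of_gen (fun g hg => ?_) g
  cases t with
  | OA => exact hg.elim
  | FA =>
    obtain ⟨j, hj, hg⟩ := hg
    exact ⟨_, (h.2 _).apply_eq hg v⟩
  | CA => exact ⟨_, h.2.apply_eq hg v⟩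
  | BA =>
    obtain ⟨ε, -, -, h⟩ := h
    exact ⟨_, h.apply_eq hg v⟩
  | SA =>
    obtain ⟨-, h1, ε, -, -, h2⟩ := h
    rcases hg with hg | hg
    · exact ⟨_, h1.apply_eq hg v⟩
    · exact ⟨_, h2.apply_eq hg v⟩

/-- For a singular pair `(λ, μ)`, the image of `Δ_{n+1,λ}` is contained in every nonzero submodule
of `Δ_{n,μ}`. -/
theorem range_le_of_ne_bot {l : Rep.{u} k (Aut n.next)} (hl : l.ρ.IsIrreducible)
    {μ : Rep.{u} k (Aut n)} (hμ : μ.ρ.IsIrreducible) (φ : DeltaIrr l ⟶ DeltaIrr μ) (hφ : φ ≠ 0)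
    {S : Submod (DeltaIrr μ)} (hS : S ≠ ⊥) : Submod.range φ ≤ S := by
  by_cases hS' : S = ⊤
  · rw [hS']
    exact le_top
  obtain ⟨x, hxS, hx0, hx⟩ := exists_mem_killed hμ hS hS'
  obtain ⟨w, rfl⟩ := exists_altSum_of_mem_killed next_card hx
  have hw : w ≠ 0 := fun h => hx0 (by rw [h, map_zero])
  have htab : SingularTable l μ := IsSingularPair.singularTable hl hμ ⟨φ, hφ⟩
  have htop : Submod.comap φ S = ⊤ := eq_top_of_gen_mem fun u => by
    obtain ⟨v, hv⟩ := exists_altSum_of_mem_killed next_card (apply_gen_mem_killed φ u)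
    obtain ⟨c, rfl⟩ := Rep.exists_eq_smul hμ hw (htab.exists_smul_right w) v
    change (φ.app n.next).hom (gen l (𝟙 _) u) ∈ S.carrier n.next
    rw [hv, map_smul]
    exact Submodule.smul_mem _ _ hxS
  rintro m _ ⟨x, rfl⟩
  have : x ∈ (Submod.comap φ S).carrier m := by rw [htop, Submod.carrier_top]; trivial
  exact this

theorem nonempty_top_iso_socle {l : Rep.{u} k (Aut n.next)} (hl : l.ρ.IsIrreducible)
    {μ : Rep.{u} k (Aut n)} (hμ : μ.ρ.IsIrreducible) (h : IsSingularPair l μ) :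
    Nonempty (top (DeltaIrr l) ≅ socle (DeltaIrr μ)) := by
  obtain ⟨φ, hφ⟩ := h
  have hR : Submod.range φ ≠ ⊥ := fun H => by
    obtain ⟨X, x, hx⟩ := CatMod.exists_ne_zero_of_hom_ne_zero hφ
    have : (φ.app X).hom x ∈ (Submod.range φ).carrier X := ⟨x, rfl⟩
    rw [H, Submod.carrier_bot] at this
    exact hx ((Submodule.mem_bot k).1 this)
  have hle : ∀ {S : Submod (DeltaIrr μ)}, S ≠ ⊥ → Submod.range φ ≤ S :=
    fun hS => range_le_of_ne_bot hl hμ φ hφ hS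
  have hatom : IsAtom (Submod.range φ) :=
    ⟨hR, fun S hS => by_contra fun h => hS.not_ge (hle h)⟩
  have hset : {S : Submod (DeltaIrr μ) | IsAtom S} = {Submod.range φ} :=
    Set.eq_singleton_iff_unique_mem.2 ⟨hatom, fun S hS =>
      ((hS.le_iff.1 (hle hS.1)).resolve_left hR).symm⟩
  have hsoc : socle (DeltaIrr μ) = (Submod.range φ).toMod := by
    rw [socle, hset]
    exact congrArg Submod.toMod sSup_singleton
  rw [hsoc]
  refine nonempty_top_iso hl (Submod.simple_toMod hatom)
    (φ := Submod.codRestrict _ φ fun X x => ⟨x, rfl⟩) fun H => hφ ?_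
  ext X x
  have := congrArg (fun ψ : DeltaIrr l ⟶ (Submod.range φ).toMod => (ψ.app X).hom x) H
  exact congrArg Subtype.val this

/-! ### The classification -/

/-- Every simple module `V` is the top of some `Δ_{n,λ}`: take for `[n]` the smallest object at
which `V` does not vanish, and `λ = V([n])`. -/
theorem exists_nonempty_top_iso {V : CatMod (Obj t) k} (hV : Simple V) :
    ∃ (n : Obj t) (l : Rep.{u} k (Aut n)), l.ρ.IsIrreducible ∧ Nonempty (top (DeltaIrr l) ≅ V) := by
  classical
  obtain ⟨⟨X, x₀, hx₀⟩, hS⟩ := CatMod.simple_iff.1 hV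
  have hex : ∃ N : ℕ, ∃ n : Obj t, (n.card : ℕ) = N ∧ ∃ x : V.obj n, x ≠ 0 :=
    ⟨_, X, rfl, x₀, hx₀⟩
  obtain ⟨n, hn, x, hx⟩ := Nat.find_spec hex
  have hmin : ∀ p : Obj t, (p.card : ℕ) < n.card → ∀ y : V.obj p, y = 0 := by
    intro p hp y
    by_contra hy
    exact Nat.find_min hex (hn ▸ hp) ⟨p, rfl, y, hy⟩
  have hkill : ∀ y : V.obj n, y ∈ killed V n := fun y =>
    mem_killed_of_merge fun p hp j hj g => hmin p (by omega) _
  have hl : (autRep V n).ρ.IsIrreducible := by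
    refine { exists_pair_ne := ⟨⊥, ⊤, fun h => hx ?_⟩, eq_bot_or_eq_top := fun W => ?_ }
    · have : x ∈ (⊥ : Subrepresentation (autRep V n).ρ) := by rw [h]; trivial
      exact (Submodule.mem_bot k).1 this
    · have hW : (Submod.colon V n W.toSubmodule).carrier n = W.toSubmodule := by
        ext y
        refine ⟨fun hy => ?_, fun hy => Submod.mem_colon.2 fun f => ?_⟩
        · have := Submod.mem_colon.1 hy (𝟙 n)
          rwa [CatMod.map_id_apply] at this
        · by_cases hf : Function.Injective f.1
          · obtain ⟨g, rfl⟩ := exists_aut_of_injective f hf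
            exact W.apply_mem_toSubmodule g hy
          · rw [mem_killed.1 (hkill y) n f hf]
            exact zero_mem _
      refine (hS (Submod.colon V n W.toSubmodule)).imp (fun h => ?_) fun h => ?_
      · refine Subrepresentation.toSubmodule_injective ?_
        rw [← hW, h, Submod.carrier_bot]
        rfl
      · refine Subrepresentation.toSubmodule_injective ?_
        rw [← hW, h, Submod.carrier_top]
        rfl
  have h0 : ∀ (m : Obj t) (f : n ⟶ m), ¬ Function.Injective f.1 → ∀ v : V.obj n,
      (V.map f).hom v = 0 := fun m f hf v => mem_killed.1 (hkill v) m f hf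
  refine ⟨n, autRep V n, hl, nonempty_top_iso hl hV
    (φ := desc (LinearMap.id : V.obj n →ₗ[k] V.obj n) (fun g v => rfl) h0) fun H => hx ?_⟩
  have := desc_gen (l := autRep V n) (LinearMap.id : V.obj n →ₗ[k] V.obj n) (fun g v => rfl) h0
    (𝟙 n) x
  rw [H, CatMod.map_id_apply] at this
  exact this.symm

theorem card_le_of_top_iso {l : Rep.{u} k (Aut n)} (hl : l.ρ.IsIrreducible)
    {l' : Rep.{u} k (Aut m)} (e : top (DeltaIrr l) ≅ top (DeltaIrr l')) :
    (m.card : ℕ) ≤ n.card := by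
  by_contra h
  obtain ⟨v, hv⟩ := Rep.exists_ne_zero hl
  obtain ⟨i⟩ := nonempty_iso_autRep_top hl
  have hz : ∀ y : (top (DeltaIrr l')).obj n, y = 0 := fun y => by
    obtain ⟨x, rfl⟩ := (radical (DeltaIrr l')).proj_surjective n y
    rw [eq_zero_of_card_lt (by omega) x]
    exact map_zero _
  refine hv ((Representation.equivOfIso i).toLinearEquiv.injective
    ((CatMod.bijective_of_iso e n).1 ((hz _).trans (hz _).symm)))

theorem isoClass_eq_iff {D : Type*} [Category D] {X Y : D} :
    isoClass X = isoClass Y ↔ Nonempty (X ≅ Y) :=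
  Quotient.eq (r := isIsomorphicSetoid D)

/-- The irreducible module attached to `(n, λ)`: the top of `Δ_{n,λ}`. -/
def topClass (x : Σ n : Obj t, Irr k (Aut n)) : IrrMod (Obj t) k :=
  ⟨isoClass (top (DeltaIrr x.2.2.choose)), _, simple_top x.2.2.choose_spec.1, rfl⟩

theorem topClass_mk (l : Rep.{u} k (Aut n)) (hl : l.ρ.IsIrreducible) :
    (topClass ⟨n, Irr.mk l hl⟩).1 = isoClass (top (DeltaIrr l)) := by
  obtain ⟨h1, h2⟩ := (Irr.mk l hl).2.choose_spec
  obtain ⟨e⟩ := isoClass_eq_iff.1 h2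
  exact isoClass_eq_iff.2 (nonempty_top_iso_of_iso h1 hl e)

theorem topClass_bijective :
    Function.Bijective (topClass : (Σ n : Obj t, Irr k (Aut n)) → IrrMod (Obj t) k) := by
  constructor
  · rintro ⟨n, _, l, hl, rfl⟩ ⟨m, _, l', hl', rfl⟩ h
    have h : (topClass ⟨n, Irr.mk l hl⟩).1 = (topClass ⟨m, Irr.mk l' hl'⟩).1 := congrArg _ h
    rw [topClass_mk, topClass_mk, isoClass_eq_iff] at h
    obtain ⟨e⟩ := h
    obtain rfl : n = m :=
      Obj.eq_of_card_eq (le_antisymm (card_le_of_top_iso hl' e.symm) (card_le_of_top_iso hl e))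
    obtain ⟨i⟩ := nonempty_iso_autRep_top hl
    obtain ⟨i'⟩ := nonempty_iso_autRep_top hl'
    obtain ⟨j⟩ := autRep_nonempty_iso e n
    exact congrArg (Sigma.mk n) (Subtype.ext (isoClass_eq_iff.2 ⟨i ≪≫ j ≪≫ i'.symm⟩))
  · rintro ⟨_, V, hV, rfl⟩
    obtain ⟨n, l, hl, h⟩ := exists_nonempty_top_iso hV
    exact ⟨⟨n, Irr.mk l hl⟩, Subtype.ext ((topClass_mk l hl).trans (isoClass_eq_iff.2 h))⟩

end Standard

end

theorem mainTheorem5 (t : CameronType) (k : Type u) [Field k] [CharZero k] :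
    (∀ (n : Obj t) (μ : Rep.{u} k (Aut n)), μ.ρ.IsIrreducible →
      (IsSingular μ ↔
        ∃ l : Rep.{u} k (Aut n.next), l.ρ.IsIrreducible ∧ SingularTable l μ) ∧
      ∀ l : Rep.{u} k (Aut n.next), l.ρ.IsIrreducible →
        (IsSingularPair l μ ↔ SingularTable l μ)) ∧
    ∃ Φ : (Σ n : Obj t, Irr k (Aut n)) ≃ IrrMod (Obj t) k,
      (∀ (n : Obj t) (l : Rep.{u} k (Aut n)) (hl : l.ρ.IsIrreducible),
        (¬ IsSingular l → (Φ ⟨n, Irr.mk l hl⟩).1 = isoClass (DeltaIrr l)) ∧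
        (IsSingular l → (Φ ⟨n, Irr.mk l hl⟩).1 = isoClass (top (DeltaIrr l)))) ∧
      (∀ (n : Obj t) (l : Rep.{u} k (Aut n.next)) (hl : l.ρ.IsIrreducible)
        (μ : Rep.{u} k (Aut n)), μ.ρ.IsIrreducible → IsSingularPair l μ →
        (Φ ⟨n.next, Irr.mk l hl⟩).1 = isoClass (socle (DeltaIrr μ))) := by
  refine ⟨fun n μ hμ => ⟨?_, fun l hl => isSingularPair_iff hl hμ⟩,
    Equiv.ofBijective topClass topClass_bijective, fun n l hl => ⟨fun h => ?_, fun _ => ?_⟩,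
    fun n l hl μ hμ h => ?_⟩
  · rw [isSingular_iff_exists]
    exact exists_congr fun l => and_congr_right fun hl => isSingularPair_iff hl hμ
  · have hs := DeltaIrr.simple_of_not_isSingular hl h
    exact (topClass_mk l hl).trans
      (isoClass_eq_iff.2 (DeltaIrr.nonempty_top_iso hl hs (id_nonzero (DeltaIrr l))))
  · exact topClass_mk l hl
  · exact (topClass_mk l hl).trans (isoClass_eq_iff.2 (nonempty_top_iso_socle hl hμ h))
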